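/- Theorem 4. Let $K$ be a field and let $A=\bigoplus_{i\ge 0}A_i$ be a connected graded $K$-algebra: an associative unital graded $K$-algebra for which $A_0$ has $K$-basis $\{1_A\}$. Let $\varepsilon:A\to K$ be the standard augmentation, $\varepsilon(1_A)=1_K$ and $\varepsilon(A_i)=0$ for $i>0$, by which $K$ becomes a left $A$-module, a right $A$-module and an $(A,A)$-bimodule. Let $n\ge 0$. The algebra $A$ is called left-$FP_n$, right-$FP_n$, weak bi-$FP_n$ or bi-$FP_n$ if there is an exact sequence $$0\leftarrow M\leftarrow P_0\leftarrow P_1\leftarrow\cdots\leftarrow P_n$$ with each $P_i$ free of finite rank, in the category of, respectively, left $A$-modules with $M=K$, right $A$-modules with $M=K$, $(A,A)$-bimodules with $M=K$, and $(A,A)$-bimodules with $M=A$ (under left and right multiplication); here a free $(A,A)$-bimodule of rank $r$ is a direct sum of $r$ copies of $A\otimes_K A$. If $A$ is left-$FP_n$ or right-$FP_n$, then $A$ is bi-$FP_n$. Moreover the four properties left-$FP_n$, right-$FP_n$, weak bi-$FP_n$ and bi-$FP_n$ are all equivalent for $A$. They are also equivalent to each of the corresponding four properties in the graded sense, where $K$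 is concentrated in degree $0$, the $P_i$ are required to be graded (free on finitely many homogeneous basis elements) and the maps are required to preserve degrees. -/

import Mathlib

open scoped TensorProduct

namespace HomFin

/-! ### Modules of type `FP_n` -/

/-- The left `R`-module `M` is of type `FP_n`: there is an exact sequence
`0 ← M ← P_0 ← P_1 ← ⋯ ← P_n` of left `R`-modules, where `P_i = R ^ (r i)` is free of finite rank.
Only `r i` for `i ≤ n` and `d i : P_{i+1} → P_i` for `i < n` are constrained. -/
def IsFP (R M : Type*) [Ring R] [AddCommGroup M] [Module R M] (n : ℕ) : Prop :=
  ∃ (r : ℕ → ℕ) (p : (Fin (r 0) → R) →ₗ[R] M)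
    (d : ∀ i, (Fin (r (i + 1)) → R) →ₗ[R] (Fin (r i) → R)),
    Function.Surjective p ∧
    (1 ≤ n → Function.Exact (d 0) p) ∧
    ∀ i, i + 2 ≤ n → Function.Exact (d (i + 1)) (d i)

/-- The grading on the free module `R ^ r` in which the `l`-th basis vector has degree `deg l`:
an element is homogeneous of degree `j` if its `l`-th coordinate lies in `R_{j - deg l}`
(which is `0` if `j < deg l`). -/
def freeGrading {K R : Type*} [CommRing K] [Ring R] [Algebra K R] (𝓡 : ℕ → Submodule K R)
    {r : ℕ} (deg : Fin r → ℕ) (j : ℕ) : Submodule K (Fin r → R) :=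
  Submodule.pi Set.univ fun l => if deg l ≤ j then 𝓡 (j - deg l) else ⊥

/-- A map is graded (of degree `0`) if it maps elements of degree `j` to elements of degree `j`. -/
def IsGradedMap {K M L : Type*} [CommRing K] [AddCommGroup M] [Module K M]
    [AddCommGroup L] [Module K L] (ℳ : ℕ → Submodule K M) (𝓛 : ℕ → Submodule K L)
    (f : M → L) : Prop :=
  ∀ j, ∀ x ∈ ℳ j, f x ∈ 𝓛 j

/-- For a graded `K`-algebra `R = ⨁ 𝓡 i` and a graded left `R`-module `M = ⨁ ℳ i`: the module `M`
is of type `FP_n` in the graded sense, i.e. there is an exact sequence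
`0 ← M ← P_0 ← P_1 ← ⋯ ← P_n` of graded left `R`-modules and graded maps, where
`P_i = R ^ (r i)` is free of finite rank on homogeneous basis elements of degrees `deg i l`. -/
def IsGradedFP {K R M : Type*} [CommRing K] [Ring R] [Algebra K R] [AddCommGroup M] [Module K M]
    [Module R M] (𝓡 : ℕ → Submodule K R) (ℳ : ℕ → Submodule K M) (n : ℕ) : Prop :=
  ∃ (r : ℕ → ℕ) (deg : ∀ i, Fin (r i) → ℕ) (p : (Fin (r 0) → R) →ₗ[R] M)
    (d : ∀ i, (Fin (r (i + 1)) → R) →ₗ[R] (Fin (r i) → R)),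
    (Function.Surjective p ∧
      (1 ≤ n → Function.Exact (d 0) p) ∧
      ∀ i, i + 2 ≤ n → Function.Exact (d (i + 1)) (d i)) ∧
    IsGradedMap (freeGrading 𝓡 (deg 0)) ℳ p ∧
    ∀ i, i + 1 ≤ n →
      IsGradedMap (freeGrading 𝓡 (deg (i + 1))) (freeGrading 𝓡 (deg i)) (d i)

section Algebras

variable {K A : Type*} [CommRing K] [Ring A] [Algebra K A]

/-! ### The ground ring as a module, via an augmentation `ε : A → K`

Right `A`-modules are left `Aᵐᵒᵖ`-modules, and `(A, A)`-bimodules are left modules over the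
enveloping algebra `A ⊗[K] Aᵐᵒᵖ`, with `(a ⊗ op b) • m = a m b`. -/

/-- The augmentation `b ↦ ε b` of the opposite algebra. -/
def opAugmentation (ε : A →ₐ[K] K) : Aᵐᵒᵖ →ₐ[K] K :=
  ε.fromOpposite fun _ _ => Commute.all _ _

/-- The augmentation `a ⊗ op b ↦ ε a * ε b` of the enveloping algebra. -/
noncomputable def envAugmentation (ε : A →ₐ[K] K) : A ⊗[K] Aᵐᵒᵖ →ₐ[K] K :=
  Algebra.TensorProduct.lift ε (opAugmentation ε) fun _ _ => Commute.all _ _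

theorem opAugmentation_op (ε : A →ₐ[K] K) (b : A) :
    opAugmentation ε (MulOpposite.op b) = ε b := rfl

theorem envAugmentation_tmul (ε : A →ₐ[K] K) (a b : A) :
    envAugmentation ε (a ⊗ₜ[K] MulOpposite.op b) = ε a * ε b := by
  simp [envAugmentation, opAugmentation_op]

/-- `K` as a left `A`-module, `a • k = ε a * k`. -/
abbrev leftModule (ε : A →ₐ[K] K) : Module A K :=
  Module.compHom K ε.toRingHom

/-- `K` as a right `A`-module, `k • a = k * ε a`. -/
abbrev rightModule (ε : A →ₐ[K] K) : Module Aᵐᵒᵖ K :=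
  Module.compHom K (opAugmentation ε).toRingHom

/-- `K` as an `(A, A)`-bimodule, `a • k • b = ε a * k * ε b`. -/
noncomputable abbrev biModule (ε : A →ₐ[K] K) : Module (A ⊗[K] Aᵐᵒᵖ) K :=
  Module.compHom K (envAugmentation ε).toRingHom

variable (K A) in
/-- `A` as an `(A, A)`-bimodule, by left and right multiplication. -/
noncomputable abbrev selfBimodule : Module (A ⊗[K] Aᵐᵒᵖ) A :=
  TensorProduct.Algebra.module

theorem selfBimodule_smul (a b m : A) :
    letI := selfBimodule K A
    (a ⊗ₜ[K] MulOpposite.op b) • m = a * m * b := by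
  let := selfBimodule K A
  change (a ⊗ₜ[K] MulOpposite.op b) • m = a * m * b
  rw [TensorProduct.Algebra.smul_def]
  simp [mul_assoc]

/-! ### Finiteness conditions for augmented algebras -/

/-- The algebra `A`, with augmentation `ε`, is left-`FP_n`. -/
def LeftFP (ε : A →ₐ[K] K) (n : ℕ) : Prop :=
  letI := leftModule ε
  IsFP A K n

/-- The algebra `A`, with augmentation `ε`, is right-`FP_n`. -/
def RightFP (ε : A →ₐ[K] K) (n : ℕ) : Prop :=
  letI := rightModule ε
  IsFP Aᵐᵒᵖ K n

/-- The algebra `A`, with augmentation `ε`, is weak bi-`FP_n`: the bimodule `K` has a partial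
resolution of length `n` by free bimodules of finite rank. -/
def WeakBiFP (ε : A →ₐ[K] K) (n : ℕ) : Prop :=
  letI := biModule ε
  IsFP (A ⊗[K] Aᵐᵒᵖ) K n

variable (K A) in
/-- The algebra `A` is bi-`FP_n`: the bimodule `A` has a partial resolution of length `n` by free
bimodules of finite rank. -/
def BiFP (n : ℕ) : Prop :=
  letI := selfBimodule K A
  IsFP (A ⊗[K] Aᵐᵒᵖ) A n

/-! ### The same conditions in the graded sense -/

variable (K) in
/-- The grading of `K` concentrated in degree `0`. -/
def groundGrading (i : ℕ) : Submodule K K :=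
  if i = 0 then ⊤ else ⊥

/-- The grading of the opposite algebra. -/
def opGrading (𝒜 : ℕ → Submodule K A) (i : ℕ) : Submodule K Aᵐᵒᵖ :=
  (𝒜 i).map (MulOpposite.opLinearEquiv K).toLinearMap

/-- The grading of the enveloping algebra: degree `i` is spanned by the `a ⊗ op b` with
`a ∈ A_p`, `b ∈ A_q`, `p + q = i`. -/
def envGrading (𝒜 : ℕ → Submodule K A) (i : ℕ) : Submodule K (A ⊗[K] Aᵐᵒᵖ) :=
  Submodule.span K {x | ∃ p q : ℕ, p + q = i ∧ ∃ a ∈ 𝒜 p, ∃ b ∈ 𝒜 q,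
    x = a ⊗ₜ[K] MulOpposite.op b}

/-- Left-`FP_n` in the graded sense. -/
def GradedLeftFP (𝒜 : ℕ → Submodule K A) (ε : A →ₐ[K] K) (n : ℕ) : Prop :=
  letI := leftModule ε
  IsGradedFP 𝒜 (groundGrading K) n

/-- Right-`FP_n` in the graded sense. -/
def GradedRightFP (𝒜 : ℕ → Submodule K A) (ε : A →ₐ[K] K) (n : ℕ) : Prop :=
  letI := rightModule ε
  IsGradedFP (opGrading 𝒜) (groundGrading K) n

/-- Weak bi-`FP_n` in the graded sense. -/
def GradedWeakBiFP (𝒜 : ℕ → Submodule K A) (ε : A →ₐ[K] K) (n : ℕ) : Prop :=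
  letI := biModule ε
  IsGradedFP (envGrading 𝒜) (groundGrading K) n

/-- Bi-`FP_n` in the graded sense. -/
def GradedBiFP (𝒜 : ℕ → Submodule K A) (n : ℕ) : Prop :=
  letI := selfBimodule K A
  IsGradedFP (envGrading 𝒜) 𝒜 n

end Algebras

/-! ### Connected graded algebras and their standard augmentation -/

section Connected

variable {K A : Type*} [Field K] [Ring A] [Algebra K A]

/-- The graded algebra `A = ⨁ 𝒜 i` is connected: `𝒜 0` has basis `1`. -/
structure IsConnected (𝒜 : ℕ → Submodule K A) : Prop where
  one_ne_zero : (1 : A) ≠ 0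
  zero_eq_span : 𝒜 0 = Submodule.span K {1}

variable {𝒜 : ℕ → Submodule K A} [GradedAlgebra 𝒜]

theorem IsConnected.bijective (h : IsConnected 𝒜) :
    Function.Bijective (algebraMap K (𝒜 0)) := by
  have : Nontrivial A := ⟨1, 0, h.one_ne_zero⟩
  constructor
  · intro x y hxy
    exact (algebraMap K A).injective (congrArg Subtype.val hxy)
  · rintro ⟨x, hx⟩
    rw [h.zero_eq_span, Submodule.mem_span_singleton] at hx
    obtain ⟨c, rfl⟩ := hx
    exact ⟨c, Subtype.ext (Algebra.algebraMap_eq_smul_one (A := A) c)⟩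

/-- The standard augmentation `A → K` of a connected graded algebra: the projection onto `𝒜 0`,
followed by the inverse of `K ≃ 𝒜 0`. -/
noncomputable def IsConnected.augmentation (h : IsConnected 𝒜) : A →ₐ[K] K where
  __ := (RingEquiv.ofBijective (algebraMap K (𝒜 0)) h.bijective).symm.toRingHom.comp
    (GradedRing.projZeroRingHom' 𝒜)
  commutes' := fun c => by
    change (RingEquiv.ofBijective (algebraMap K (𝒜 0)) h.bijective).symm
      (GradedRing.projZeroRingHom' 𝒜 (algebraMap K A c)) = c
    rw [RingEquiv.symm_apply_eq]
    exact GradedRing.projZeroRingHom'_apply_coe 𝒜 (algebraMap K (𝒜 0) c)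

/-- The standard augmentation vanishes in positive degrees. -/
theorem IsConnected.augmentation_apply_of_mem (h : IsConnected 𝒜) {i : ℕ} (hi : 0 < i) {a : A}
    (ha : a ∈ 𝒜 i) : h.augmentation a = 0 := by
  change (RingEquiv.ofBijective (algebraMap K (𝒜 0)) h.bijective).symm
      (GradedRing.projZeroRingHom' 𝒜 a) = 0
  have : GradedRing.projZeroRingHom' 𝒜 a = 0 := by
    ext
    simpa using DirectSum.decompose_of_mem_ne 𝒜 ha hi.ne'
  rw [this, map_zero]

end Connected

end HomFin

/-! Write `Aᵉ` for `A ⊗[K] Aᵐᵒᵖ`. The heart is a comparison along a surjection `φ : R → S` whose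
kernel lies in positive degrees of a graded ring `R` and is generated by elements coming from a ring
`B` acting on `R` (`Grading.isFP_iff_of_surjective`). For a graded `R`-module `M` projective over
`B`, with base change `N` along `φ`, graded Nakayama turns generators of `N` into generators of `M`.
Since `M` is `B`-projective, the kernel of a free cover of `M` splits off over `B`, so it base
changes to the kernel of the cover of `N`, and induction applies. Hence `M` is `FP_n` over `R`
exactly when `N` is over `S`.

Take `R = Aᵉ`. Killing the right action by `ε` turns the bimodule `A`, free of rank one over `Aᵐᵒᵖ`,
into the left module `K`, so bi-`FP_n` is left-`FP_n`; by symmetry it is right-`FP_n`. The same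
comparison shows that `A` with its right action replaced by `ε` is `FP_n` over `Aᵉ` exactly when `A`
is right-`FP_n`. Once this bimodule is `FP_n`, `FP` properties of `K` pass between `Aᵉ` and `A` by
change of rings (`IsFP.restrictScalars`, `IsFP.extendScalars`), which handles weak bi-`FP_n`.

For the graded versions, a finitely generated graded module has a graded free cover of finite rank,
and `FP_{n+1}` of a module is `FP_n` of the kernel of any such cover (`isFP_succ_iff_ker`), so
graded covers can be chosen at every stage. -/

namespace HomFin

universe u v w

/-! ### Modules of type `FP_n` in short exact sequences -/

section Resolutions

variable {R : Type v} [Ring R]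

theorem IsFP.mono {M : Type*} [AddCommGroup M] [Module R M] {m n : ℕ} (hmn : m ≤ n)
    (h : IsFP R M n) : IsFP R M m := by
  obtain ⟨r, p, d, hp, h0, hd⟩ := h
  exact ⟨r, p, d, hp, fun h => h0 (h.trans hmn), fun i hi => hd i (hi.trans hmn)⟩

theorem IsFP.of_equiv {M N : Type*} [AddCommGroup M] [Module R M] [AddCommGroup N] [Module R N]
    {n : ℕ} (e : M ≃ₗ[R] N) (h : IsFP R M n) : IsFP R N n := by
  obtain ⟨r, p, d, hp, h0, hd⟩ := h
  refine ⟨r, e.toLinearMap ∘ₗ p, d, e.surjective.comp hp, fun h x => ?_, hd⟩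
  rw [← h0 h x]
  simp

theorem isFP_congr {M N : Type*} [AddCommGroup M] [Module R M] [AddCommGroup N] [Module R N]
    {n : ℕ} (e : M ≃ₗ[R] N) : IsFP R M n ↔ IsFP R N n :=
  ⟨.of_equiv e, .of_equiv e.symm⟩

theorem isFP_zero_iff {M : Type*} [AddCommGroup M] [Module R M] :
    IsFP R M 0 ↔ Module.Finite R M := by
  constructor
  · rintro ⟨r, p, -, hp, -⟩
    exact Module.Finite.of_surjective p hp
  · intro h
    obtain ⟨r, p, hp⟩ := Module.Finite.exists_fin' R M
    exact ⟨fun _ => r, p, fun _ => 0, hp, by simp, by simp⟩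

theorem IsFP.finite {M : Type*} [AddCommGroup M] [Module R M] {n : ℕ} (h : IsFP R M n) :
    Module.Finite R M :=
  isFP_zero_iff.1 (h.mono n.zero_le)

theorem isFP_of_subsingleton {M : Type*} [AddCommGroup M] [Module R M] [Subsingleton M] (n : ℕ) :
    IsFP R M n :=
  ⟨fun _ => 0, 0, fun _ => 0, fun _ => ⟨0, Subsingleton.elim _ _⟩,
    fun _ _ => ⟨fun _ => ⟨0, Subsingleton.elim _ _⟩, fun _ => Subsingleton.elim _ _⟩,
    fun _ _ _ => ⟨fun _ => ⟨0, Subsingleton.elim _ _⟩, fun _ => Subsingleton.elim _ _⟩⟩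

theorem isFP_succ_of_ker {M : Type*} [AddCommGroup M] [Module R M] {n r₀ : ℕ}
    (p₀ : (Fin r₀ → R) →ₗ[R] M) (hp₀ : Function.Surjective p₀)
    (h : IsFP R (LinearMap.ker p₀) n) : IsFP R M (n + 1) := by
  obtain ⟨r, p, d, hp, h0, hd⟩ := h
  let r' : ℕ → ℕ := fun
    | 0 => r₀
    | i + 1 => r i
  let d' : ∀ i, (Fin (r' (i + 1)) → R) →ₗ[R] (Fin (r' i) → R) := fun
    | 0 => (LinearMap.ker p₀).subtype ∘ₗ p
    | i + 1 => d i
  refine ⟨r', p₀, d', hp₀, fun _ x => ⟨fun hx => ?_, ?_⟩, fun i hi => ?_⟩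
  · obtain ⟨y, hy⟩ := hp ⟨x, hx⟩
    exact ⟨y, congrArg Subtype.val hy⟩
  · rintro ⟨y, rfl⟩
    exact (p y).2
  · cases i with
    | zero =>
      intro x
      refine Iff.trans ?_ (h0 (by omega) x)
      exact Submodule.coe_eq_zero
    | succ i => exact hd i (by omega)

theorem IsFP.exists_ker {M : Type*} [AddCommGroup M] [Module R M] {n : ℕ}
    (h : IsFP R M (n + 1)) : ∃ (r : ℕ) (p : (Fin r → R) →ₗ[R] M), Function.Surjective p ∧
      IsFP R (LinearMap.ker p) n := by
  obtain ⟨r, p, d, hp, h0, hd⟩ := h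
  have h0 := h0 (by omega)
  refine ⟨r 0, p, hp, fun i => r (i + 1),
    (d 0).codRestrict _ fun x => (h0 _).2 ⟨x, rfl⟩, fun i => d (i + 1), ?_, ?_, ?_⟩
  · rintro ⟨x, hx⟩
    obtain ⟨y, rfl⟩ := (h0 x).1 hx
    exact ⟨y, rfl⟩
  · intro hn x
    refine Iff.trans ?_ (hd 0 (by omega) x)
    exact Submodule.coe_eq_zero.symm
  · exact fun i hi => hd (i + 1) (by omega)

theorem isFP_succ_of_ker_of_free {F M : Type*} [AddCommGroup F] [Module R F] [AddCommGroup M]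
    [Module R M] {n r : ℕ} (e : (Fin r → R) ≃ₗ[R] F) (p : F →ₗ[R] M) (hp : Function.Surjective p)
    (h : IsFP R (LinearMap.ker p) n) : IsFP R M (n + 1) := by
  refine isFP_succ_of_ker (p ∘ₗ e.toLinearMap) (hp.comp e.surjective) (h.of_equiv ?_)
  exact (LinearEquiv.ofSubmodule' e (LinearMap.ker p)).symm

theorem isFP_pi (r n : ℕ) : IsFP R (Fin r → R) n := by
  cases n with
  | zero => exact isFP_zero_iff.2 inferInstance
  | succ n =>
    refine isFP_succ_of_ker LinearMap.id Function.surjective_id ?_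
    rw [LinearMap.ker_id]
    exact isFP_of_subsingleton n

/-- Horseshoe lemma: covers of `L` and `M` combine to a cover of `N`, after lifting the cover of `M`
through `g`. The kernels again form a short exact sequence. -/
theorem IsFP.extension {L N M : Type v} [AddCommGroup L] [Module R L] [AddCommGroup N] [Module R N]
    [AddCommGroup M] [Module R M] {n : ℕ} {f : L →ₗ[R] N} {g : N →ₗ[R] M}
    (hf : Function.Injective f) (hfg : Function.Exact f g) (hg : Function.Surjective g)
    (hL : IsFP R L n) (hM : IsFP R M n) : IsFP R N n := by
  induction n generalizing L N M with
  | zero =>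
    rw [isFP_zero_iff] at *
    exact Module.Finite.of_exact hfg hg
  | succ n ih =>
    obtain ⟨a, p, hp, hkp⟩ := hL.exists_ker
    obtain ⟨b, q, hq, hkq⟩ := hM.exists_ker
    obtain ⟨s, hs⟩ := Module.projective_lifting_property g q hg
    have hs' : ∀ x, g (s x) = q x := fun x => LinearMap.congr_fun hs x
    have hgf : ∀ x, g (f x) = 0 := fun x => (hfg _).2 ⟨x, rfl⟩
    let P : ((Fin a → R) × (Fin b → R)) →ₗ[R] N := (f ∘ₗ p).coprod s
    have hP : ∀ x, P x = f (p x.1) + s x.2 := fun x => rfl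
    have e : (Fin (a + b) → R) ≃ₗ[R] (Fin a → R) × (Fin b → R) :=
      (LinearEquiv.funCongrLeft R R finSumFinEquiv).trans
        (LinearEquiv.sumArrowLequivProdArrow (Fin a) (Fin b) R R)
    refine isFP_succ_of_ker_of_free e P (fun y => ?_) ?_
    · obtain ⟨x₂, h₂⟩ := hq (g y)
      obtain ⟨l, hl⟩ := (hfg (y - s x₂)).1 (by rw [map_sub, hs', h₂, sub_self])
      obtain ⟨x₁, rfl⟩ := hp l
      exact ⟨(x₁, x₂), by rw [hP, hl, sub_add_cancel]⟩
    · refine ih (L := LinearMap.ker p) (M := LinearMap.ker q)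
        (f := (LinearMap.inl R _ _ ).restrict fun x hx => ?_)
        (g := (LinearMap.snd R _ _).restrict fun x hx => ?_) ?_ ?_ ?_ hkp hkq
      · rw [LinearMap.mem_ker] at *
        simp [hP, hx]
      · rw [LinearMap.mem_ker] at *
        have := congrArg g (hP x)
        rw [hx, map_zero, map_add, hgf, zero_add, hs'] at this
        exact this.symm
      · intro x y hxy
        exact Subtype.ext (congrArg (fun z => z.1.1) hxy)
      · rintro ⟨⟨x, y⟩, hxy⟩
        constructor
        · intro h
          obtain rfl : y = 0 := congrArg Subtype.val h
          rw [LinearMap.mem_ker, hP, map_zero, add_zero] at hxy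
          exact ⟨⟨x, hf (hxy.trans (map_zero f).symm)⟩, rfl⟩
        · rintro ⟨z, hz⟩
          rw [← hz]
          rfl
      · rintro ⟨y, hy⟩
        obtain ⟨l, hl⟩ := (hfg (s y)).1 (by rw [hs', hy])
        obtain ⟨x, rfl⟩ := hp l
        refine ⟨⟨(-x, y), ?_⟩, rfl⟩
        rw [LinearMap.mem_ker, hP, map_neg, map_neg, hl, neg_add_cancel]

/-- If `p` covers `N`, then `g ∘ p` covers `M`, and its kernel is an extension of `ker g ≃ L` by
`ker p`. -/
theorem IsFP.quotient {L N : Type v} {M : Type w} [AddCommGroup L] [Module R L] [AddCommGroup N]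
    [Module R N] [AddCommGroup M] [Module R M] {n : ℕ} {f : L →ₗ[R] N} {g : N →ₗ[R] M}
    (hf : Function.Injective f) (hfg : Function.Exact f g) (hg : Function.Surjective g)
    (hN : IsFP R N (n + 1)) (hL : IsFP R L n) : IsFP R M (n + 1) := by
  obtain ⟨r, p, hp, hkp⟩ := hN.exists_ker
  have hL' : IsFP R (LinearMap.ker g) n := by
    refine hL.of_equiv ((LinearEquiv.ofInjective f hf).trans (LinearEquiv.ofEq _ _ ?_))
    exact (LinearMap.exact_iff.1 hfg).symm
  refine isFP_succ_of_ker (g ∘ₗ p) (hg.comp hp) ?_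
  refine IsFP.extension (L := LinearMap.ker p) (M := LinearMap.ker g)
    (f := Submodule.inclusion (LinearMap.ker_le_ker_comp p g)) (g := p.restrict fun x hx => hx)
    (Submodule.inclusion_injective _) ?_ ?_ hkp hL'
  · rintro ⟨x, hx⟩
    constructor
    · intro h
      exact ⟨⟨x, congrArg Subtype.val h⟩, rfl⟩
    · rintro ⟨y, hy⟩
      rw [← hy]
      exact Subtype.ext y.2
  · rintro ⟨y, hy⟩
    obtain ⟨x, rfl⟩ := hp y
    exact ⟨⟨x, hy⟩, rfl⟩

/-- Schanuel's argument. The pullback `X` of a free cover `p` of `M` and of `g` is an extension of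
`N` by `ker p`, hence `FP_n`. Lifting `p` through `g` exhibits `ker g` as the quotient of `X` by a
free module. -/
theorem IsFP.kernel {L N : Type v} {M : Type w} [AddCommGroup L] [Module R L] [AddCommGroup N]
    [Module R N] [AddCommGroup M] [Module R M] {n : ℕ} {f : L →ₗ[R] N} {g : N →ₗ[R] M}
    (hf : Function.Injective f) (hfg : Function.Exact f g) (hg : Function.Surjective g)
    (hN : IsFP R N n) (hM : IsFP R M (n + 1)) : IsFP R L n := by
  obtain ⟨r, p, hp, hkp⟩ := hM.exists_ker
  obtain ⟨h, hh⟩ := Module.projective_lifting_property g p hg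
  have hh' : ∀ x, g (h x) = p x := fun x => LinearMap.congr_fun hh x
  let X := LinearMap.ker (p ∘ₗ LinearMap.fst R (Fin r → R) N - g ∘ₗ LinearMap.snd R (Fin r → R) N)
  have hX : ∀ z, z ∈ X ↔ p z.1 = g z.2 := fun z => by
    rw [LinearMap.mem_ker, LinearMap.sub_apply, sub_eq_zero]
    rfl
  have hXn : IsFP R X n := by
    refine IsFP.extension (L := LinearMap.ker p) (M := N)
      (f := (LinearMap.inl R _ _).restrict fun x hx => ?_)
      (g := LinearMap.snd R _ _ ∘ₗ X.subtype) ?_ ?_ ?_ hkp hN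
    · rw [hX]
      simpa using hx
    · intro x y hxy
      exact Subtype.ext (congrArg (fun z => z.1.1) hxy)
    · rintro ⟨⟨x, y⟩, hxy⟩
      constructor
      · intro h
        obtain rfl : y = 0 := h
        exact ⟨⟨x, by simpa [hX] using hxy⟩, rfl⟩
      · rintro ⟨z, hz⟩
        rw [← hz]
        rfl
    · intro y
      obtain ⟨x, hx⟩ := hp (g y)
      exact ⟨⟨(x, y), (hX _).2 hx⟩, rfl⟩
  -- `(x, y) ↦ y - h x` has kernel the graph of `h`, a copy of `R ^ r`.
  let q : X →ₗ[R] LinearMap.ker g :=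
    (LinearMap.snd R (Fin r → R) N - h ∘ₗ LinearMap.fst R (Fin r → R) N).restrict fun x hx => by
      have := (hX x).1 hx
      simp [hh', this]
  have hq : Function.Surjective q := by
    rintro ⟨y, hy⟩
    refine ⟨⟨(0, y), (hX _).2 ?_⟩, Subtype.ext ?_⟩
    · rw [map_zero]
      exact hy.symm
    · exact (congrArg (y - ·) (map_zero h)).trans (sub_zero y)
  suffices IsFP R (LinearMap.ker g) n by
    refine this.of_equiv ((LinearEquiv.ofInjective f hf).trans (LinearEquiv.ofEq _ _ ?_)).symm
    exact (LinearMap.exact_iff.1 hfg).symm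
  cases n with
  | zero =>
    rw [isFP_zero_iff] at *
    exact Module.Finite.of_surjective q hq
  | succ n =>
    refine IsFP.quotient (f := (LinearMap.id.prod h).codRestrict X fun x => ?_) (g := q)
      ?_ ?_ hq hXn (isFP_pi r n)
    · rw [hX]
      exact (hh' x).symm
    · intro x y hxy
      exact congrArg (fun z => z.1.1) hxy
    · rintro ⟨⟨x, y⟩, hxy⟩
      constructor
      · intro hz
        have : y - h x = 0 := congrArg Subtype.val hz
        exact ⟨x, Subtype.ext (Prod.ext rfl (sub_eq_zero.1 this).symm)⟩
      · rintro ⟨z, hz⟩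
        rw [← hz]
        exact Subtype.ext (sub_self (h z))

theorem isFP_succ_iff_ker {M : Type w} [AddCommGroup M] [Module R M] {n r : ℕ}
    (p : (Fin r → R) →ₗ[R] M) (hp : Function.Surjective p) :
    IsFP R M (n + 1) ↔ IsFP R (LinearMap.ker p) n :=
  ⟨fun h => (isFP_pi r n).kernel (Submodule.injective_subtype _)
    (LinearMap.exact_subtype_ker_map p) hp h, isFP_succ_of_ker p hp⟩

/-- Allows modules in other universes to be replaced by copies in the universe of `R`, where the
kernels of free covers live. -/
theorem IsFP.small {M : Type w} [AddCommGroup M] [Module R M] {n : ℕ} (h : IsFP R M n) :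
    Small.{v} M := by
  obtain ⟨r, p, -, hp, -⟩ := h
  exact small_of_surjective hp

theorem IsFP.pi {M : Type v} [AddCommGroup M] [Module R M] {n : ℕ} (h : IsFP R M n) (r : ℕ) :
    IsFP R (Fin r → M) n := by
  induction r with
  | zero => exact isFP_of_subsingleton n
  | succ r ih =>
    refine IsFP.extension (f := LinearMap.single R (fun _ : Fin (r + 1) => M) 0)
      (g := LinearMap.funLeft R M Fin.succ) (fun x y h => by simpa using congrFun h 0) ?_ ?_ h ih
    · intro x
      constructor
      · intro hx
        refine ⟨x 0, funext fun i => ?_⟩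
        refine Fin.cases (by simp) (fun i => ?_) i
        simpa using (congrFun hx i).symm
      · rintro ⟨y, rfl⟩
        ext i
        simp [LinearMap.funLeft_apply]
    · exact LinearMap.funLeft_surjective_of_injective _ _ _ (Fin.succ_injective r)

end Resolutions

/-! ### Change of rings -/

section RestrictScalars

variable {R S : Type v} [Ring R] [Ring S] [Module R S] [IsScalarTower R S S]

/-- Over `R`, the module `M` is the quotient of `S ^ r` by a kernel that is one step less finite, to
which induction applies. -/
theorem IsFP.restrictScalars {n : ℕ} (hS : IsFP R S n) {M : Type w} [AddCommGroup M] [Module R M]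
    [Module S M] [IsScalarTower R S M] (hM : IsFP S M n) : IsFP R M n := by
  suffices H : ∀ n (M : Type v) [AddCommGroup M] [Module R M] [Module S M] [IsScalarTower R S M],
      IsFP R S n → IsFP S M n → IsFP R M n by
    have := hM.small
    have : IsScalarTower R S (Shrink.{v} M) :=
      ⟨fun r s m => (equivShrink M).symm.injective (by simp [equivShrink_symm_smul])⟩
    exact (H n (Shrink.{v} M) hS (hM.of_equiv (Shrink.linearEquiv S M).symm)).of_equiv
      (Shrink.linearEquiv R M)
  intro n
  induction n with
  | zero =>
    intro M _ _ _ _ hS hM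
    rw [isFP_zero_iff] at *
    exact Module.Finite.trans S M
  | succ n ih =>
    intro M _ _ _ _ hS hM
    obtain ⟨r, p, hp, hkp⟩ := hM.exists_ker
    refine IsFP.quotient (f := (LinearMap.ker p).subtype.restrictScalars R)
      (g := p.restrictScalars R) (Submodule.injective_subtype _)
      (LinearMap.exact_subtype_ker_map p) hp (hS.pi r) (ih _ (hS.mono n.le_succ) hkp)

/-- The kernel of a cover `S ^ r → M` is `FP_n` over `R` by `IsFP.kernel`, so induction applies to
it. Only `FP_n` is needed of `S`, one less than for `M`; the treatment of weak bi-`FP_n` relies on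
this shift. -/
theorem IsFP.extendScalars {n : ℕ} (hS : IsFP R S n) {M : Type w} [AddCommGroup M] [Module R M]
    [Module S M] [IsScalarTower R S M] (hM : IsFP R M (n + 1)) : IsFP S M (n + 1) := by
  suffices H : ∀ n (M : Type v) [AddCommGroup M] [Module R M] [Module S M] [IsScalarTower R S M],
      IsFP R S n → IsFP R M (n + 1) → IsFP S M (n + 1) by
    have := hM.small
    have : IsScalarTower R S (Shrink.{v} M) :=
      ⟨fun r s m => (equivShrink M).symm.injective (by simp [equivShrink_symm_smul])⟩
    exact (H n (Shrink.{v} M) hS (hM.of_equiv (Shrink.linearEquiv R M).symm)).of_equiv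
      (Shrink.linearEquiv S M)
  intro n
  induction n with
  | zero =>
    intro M _ _ _ _ hS hM
    have := hM.finite
    have : Module.Finite S M := Module.Finite.of_restrictScalars_finite R S M
    obtain ⟨r, p, hp⟩ := Module.Finite.exists_fin' S M
    refine isFP_succ_of_ker p hp (isFP_zero_iff.2 ?_)
    have : Module.Finite R (LinearMap.ker p) := isFP_zero_iff.1 <|
      IsFP.kernel (f := (LinearMap.ker p).subtype.restrictScalars R)
        (g := p.restrictScalars R) (Submodule.injective_subtype _)
        (LinearMap.exact_subtype_ker_map p) hp (hS.pi r) hM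
    exact Module.Finite.of_restrictScalars_finite R S _
  | succ n ih =>
    intro M _ _ _ _ hS hM
    have := hM.finite
    have : Module.Finite S M := Module.Finite.of_restrictScalars_finite R S M
    obtain ⟨r, p, hp⟩ := Module.Finite.exists_fin' S M
    exact isFP_succ_of_ker p hp <| ih _ (hS.mono n.le_succ) <|
      IsFP.kernel (f := (LinearMap.ker p).subtype.restrictScalars R)
        (g := p.restrictScalars R) (Submodule.injective_subtype _)
        (LinearMap.exact_subtype_ker_map p) hp (hS.pi r) hM

end RestrictScalars

/-! ### Graded modules and graded resolutions -/

/-- An `ℕ`-grading of the module `M` over the graded ring `R`, given by its projections. -/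
structure Grading {K R M : Type*} [CommRing K] [Ring R] [Algebra K R] [AddCommGroup M] [Module K M]
    [Module R M] (𝓡 : ℕ → Submodule K R) (ℳ : ℕ → Submodule K M) where
  smul_mem : ∀ {i j : ℕ} {a : R} {x : M}, a ∈ 𝓡 i → x ∈ ℳ j → a • x ∈ ℳ (i + j)
  proj : ℕ → M →ₗ[K] M
  proj_of_mem : ∀ {j : ℕ} {x : M}, x ∈ ℳ j → proj j x = x
  proj_of_mem_ne : ∀ {i j : ℕ} {x : M}, x ∈ ℳ i → i ≠ j → proj j x = 0
  iSup_eq_top : ⨆ j, ℳ j = ⊤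

theorem exists_fin_span_eq_top {R M : Type*} [Ring R] [AddCommGroup M] [Module R M]
    [Module.Finite R M] {s : Set M} (hs : Submodule.span R s = ⊤) :
    ∃ (r : ℕ) (x : Fin r → M), (∀ l, x l ∈ s) ∧ Submodule.span R (Set.range x) = ⊤ := by
  obtain ⟨t, hts, ht⟩ := Submodule.fg_span_iff_fg_span_finset_subset s |>.1
    (hs ▸ Module.Finite.fg_top)
  refine ⟨t.card, fun l => t.equivFin.symm l, fun l => hts (t.equivFin.symm l).2, ?_⟩
  rw [← hs, ht]
  congr 1
  ext x
  constructor
  · rintro ⟨l, rfl⟩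
    exact (t.equivFin.symm l).2
  · intro hx
    exact ⟨t.equivFin ⟨x, hx⟩, by simp⟩

namespace Grading

section

variable {K R M M' : Type*} [CommRing K] [Ring R] [Algebra K R] [AddCommGroup M] [Module K M]
  [Module R M] [AddCommGroup M'] [Module K M'] [Module R M']
  {𝓡 : ℕ → Submodule K R} {ℳ : ℕ → Submodule K M} {ℳ' : ℕ → Submodule K M'}

theorem induction (G : Grading 𝓡 ℳ) {motive : M → Prop} (x : M)
    (mem : ∀ j, ∀ x ∈ ℳ j, motive x) (add : ∀ x y, motive x → motive y → motive (x + y)) :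
    motive x :=
  Submodule.iSup_induction ℳ (motive := motive) (G.iSup_eq_top ▸ Submodule.mem_top : x ∈ ⨆ j, ℳ j) mem
    (mem 0 0 (ℳ 0).zero_mem) add

theorem proj_mem (G : Grading 𝓡 ℳ) (j : ℕ) (x : M) : G.proj j x ∈ ℳ j := by
  induction x using G.induction with
  | mem i x hx =>
    by_cases h : i = j
    · subst h
      rwa [G.proj_of_mem hx]
    · rw [G.proj_of_mem_ne hx h]
      exact zero_mem _
  | add x y hx hy =>
    rw [map_add]
    exact add_mem hx hy

/-- Stated for all large `n`, so that the bounds for two summands have a common value. -/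
theorem eventually_sum_proj (G : Grading 𝓡 ℳ) (x : M) :
    ∀ᶠ n in Filter.atTop, ∑ j ∈ Finset.range n, G.proj j x = x := by
  induction x using G.induction with
  | mem i x hx =>
    filter_upwards [Filter.eventually_gt_atTop i] with n hn
    rw [Finset.sum_eq_single_of_mem i (Finset.mem_range.2 hn)
      fun j _ hj => G.proj_of_mem_ne hx hj.symm, G.proj_of_mem hx]
  | add x y hx hy =>
    filter_upwards [hx, hy] with n h₁ h₂
    simp_rw [map_add, Finset.sum_add_distrib, h₁, h₂]

theorem exists_sum_proj (G : Grading 𝓡 ℳ) (x : M) :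
    ∃ n, ∑ j ∈ Finset.range n, G.proj j x = x :=
  (G.eventually_sum_proj x).exists

theorem span_homogeneous (G : Grading 𝓡 ℳ) :
    Submodule.span R {x | ∃ j, x ∈ ℳ j} = ⊤ := by
  rw [eq_top_iff]
  rintro x -
  induction x using G.induction with
  | mem j x hx => exact Submodule.subset_span ⟨j, hx⟩
  | add x y hx hy => exact add_mem hx hy

theorem apply_proj (G : Grading 𝓡 ℳ) (G' : Grading 𝓡 ℳ') {p : M →ₗ[R] M'}
    (hp : IsGradedMap ℳ ℳ' p) (j : ℕ) (x : M) : p (G.proj j x) = G'.proj j (p x) := by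
  induction x using G.induction with
  | mem i x hx =>
    by_cases h : i = j
    · subst h
      rw [G.proj_of_mem hx, G'.proj_of_mem (hp _ _ hx)]
    · rw [G.proj_of_mem_ne hx h, G'.proj_of_mem_ne (hp _ _ hx) h, map_zero]
  | add x y hx hy => simp only [map_add, hx, hy]

/-- The induced grading of the kernel of a graded map. -/
def ker [IsScalarTower K R M] (G : Grading 𝓡 ℳ) (G' : Grading 𝓡 ℳ') {p : M →ₗ[R] M'}
    (hp : IsGradedMap ℳ ℳ' p) :
    Grading 𝓡 (fun j => (ℳ j).comap ((LinearMap.ker p).subtype.restrictScalars K)) where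
  smul_mem ha hx := G.smul_mem ha hx
  proj j := (G.proj j).restrict (p := (LinearMap.ker p).restrictScalars K)
    (q := (LinearMap.ker p).restrictScalars K) fun x hx => by
      have hx : p x = 0 := hx
      change p (G.proj j x) = 0
      rw [G.apply_proj G' hp, hx, map_zero]
  proj_of_mem hx := Subtype.ext (G.proj_of_mem hx)
  proj_of_mem_ne hx h := Subtype.ext (G.proj_of_mem_ne hx h)
  iSup_eq_top := by
    rw [eq_top_iff]
    rintro ⟨x, hx⟩ -
    obtain ⟨n, hn⟩ := G.exists_sum_proj x
    have hker : ∀ j, p (G.proj j x) = 0 := fun j => by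
      rw [G.apply_proj G' hp, show p x = 0 from hx, map_zero]
    have : (⟨x, hx⟩ : LinearMap.ker p) =
        ∑ j ∈ Finset.range n, ⟨G.proj j x, hker j⟩ := by
      apply Subtype.ext
      simpa using hn.symm
    rw [this]
    exact sum_mem fun j _ => Submodule.mem_iSup_of_mem j (G.proj_mem j x)

theorem _root_.HomFin.mem_freeGrading {r : ℕ} {deg : Fin r → ℕ} {j : ℕ} {x : Fin r → R} :
    x ∈ freeGrading 𝓡 deg j ↔ ∀ l, x l ∈ if deg l ≤ j then 𝓡 (j - deg l) else ⊥ := by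
  simp [freeGrading]

/-- The free module on homogeneous basis elements is graded. -/
def free (G : Grading 𝓡 𝓡) {r : ℕ} (deg : Fin r → ℕ) :
    Grading 𝓡 (freeGrading 𝓡 deg) where
  smul_mem {i j a x} ha hx := by
    rw [mem_freeGrading] at *
    intro l
    have hl := hx l
    split_ifs at hl with h
    · rw [if_pos (by omega), show i + j - deg l = i + (j - deg l) by omega]
      exact G.smul_mem ha hl
    · rw [Submodule.mem_bot] at hl
      rw [Pi.smul_apply, hl, smul_zero]
      exact zero_mem _
  proj j := LinearMap.pi fun l => if deg l ≤ j then G.proj (j - deg l) ∘ₗ LinearMap.proj l else 0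
  proj_of_mem {j x} hx := by
    rw [mem_freeGrading] at hx
    ext l
    have hl := hx l
    split_ifs at hl with h
    · simp [h, G.proj_of_mem hl]
    · rw [Submodule.mem_bot] at hl
      simp [h, hl]
  proj_of_mem_ne {i j x} hx hij := by
    rw [mem_freeGrading] at hx
    ext l
    have hl := hx l
    rw [LinearMap.pi_apply]
    by_cases hj : deg l ≤ j
    · split_ifs at hl with h
      · simp [hj, G.proj_of_mem_ne hl (show i - deg l ≠ j - deg l by omega)]
      · rw [Submodule.mem_bot] at hl
        simp [hj, hl]
    · simp [hj]
  iSup_eq_top := by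
    rw [eq_top_iff]
    rintro x -
    rw [← Finset.univ_sum_single x]
    refine sum_mem fun l _ => ?_
    induction x l using G.induction with
    | mem i a ha =>
      refine Submodule.mem_iSup_of_mem (i + deg l) (mem_freeGrading.2 fun k => ?_)
      by_cases hk : k = l
      · subst hk
        simpa using ha
      · rw [Pi.single_eq_of_ne hk]
        exact zero_mem _
    | add a b ha hb =>
      rw [Pi.single_add]
      exact add_mem ha hb

theorem isGradedMap_linearCombination [IsScalarTower K R M] (G : Grading 𝓡 ℳ) {r : ℕ}
    {deg : Fin r → ℕ} {m : Fin r → M} (hm : ∀ l, m l ∈ ℳ (deg l)) :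
    IsGradedMap (freeGrading 𝓡 deg) ℳ (Fintype.linearCombination R m) := by
  intro j x hx
  rw [mem_freeGrading] at hx
  rw [Fintype.linearCombination_apply]
  refine sum_mem fun l _ => ?_
  have hl := hx l
  split_ifs at hl with h
  · convert G.smul_mem hl (hm l)
    omega
  · rw [Submodule.mem_bot] at hl
    rw [hl, zero_smul]
    exact zero_mem _

end

section FP

variable {K : Type u} {R : Type v} [CommRing K] [Ring R] [Algebra K R]
  {𝓡 : ℕ → Submodule K R}

theorem _root_.HomFin.isGradedFP_succ_of_ker {M : Type w} [AddCommGroup M] [Module K M] [Module R M]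
    {ℳ : ℕ → Submodule K M} {n r₀ : ℕ} {deg₀ : Fin r₀ → ℕ} {p₀ : (Fin r₀ → R) →ₗ[R] M}
    (hp₀ : Function.Surjective p₀) (hgp₀ : IsGradedMap (freeGrading 𝓡 deg₀) ℳ p₀)
    (h : IsGradedFP 𝓡 (fun j => (freeGrading 𝓡 deg₀ j).comap
      ((LinearMap.ker p₀).subtype.restrictScalars K)) n) :
    IsGradedFP 𝓡 ℳ (n + 1) := by
  obtain ⟨r, deg, p, d, ⟨hp, h0, hd⟩, hgp, hgd⟩ := h
  let r' : ℕ → ℕ := fun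
    | 0 => r₀
    | i + 1 => r i
  let deg' : ∀ i, Fin (r' i) → ℕ := fun
    | 0 => deg₀
    | i + 1 => deg i
  let d' : ∀ i, (Fin (r' (i + 1)) → R) →ₗ[R] (Fin (r' i) → R) := fun
    | 0 => (LinearMap.ker p₀).subtype ∘ₗ p
    | i + 1 => d i
  refine ⟨r', deg', p₀, d', ⟨hp₀, fun _ x => ⟨fun hx => ?_, ?_⟩, fun i hi => ?_⟩, hgp₀,
    fun i hi => ?_⟩
  · obtain ⟨y, hy⟩ := hp ⟨x, hx⟩
    exact ⟨y, congrArg Subtype.val hy⟩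
  · rintro ⟨y, rfl⟩
    exact (p y).2
  · cases i with
    | zero =>
      intro x
      refine Iff.trans ?_ (h0 (by omega) x)
      exact Submodule.coe_eq_zero
    | succ i => exact hd i (by omega)
  · cases i with
    | zero => exact hgp
    | succ i => exact hgd i (by omega)

theorem exists_surjective {M : Type w} [AddCommGroup M] [Module K M] [Module R M]
    [IsScalarTower K R M] [Module.Finite R M] {ℳ : ℕ → Submodule K M} (G : Grading 𝓡 ℳ) :
    ∃ (r : ℕ) (deg : Fin r → ℕ) (p : (Fin r → R) →ₗ[R] M), Function.Surjective p ∧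
      IsGradedMap (freeGrading 𝓡 deg) ℳ p := by
  obtain ⟨r, m, hm, hspan⟩ := exists_fin_span_eq_top G.span_homogeneous
  choose deg hdeg using hm
  refine ⟨r, deg, Fintype.linearCombination R m, ?_, G.isGradedMap_linearCombination hdeg⟩
  rw [← LinearMap.range_eq_top, Fintype.range_linearCombination, hspan]

theorem isGradedFP_zero {M : Type w} [AddCommGroup M] [Module K M] [Module R M]
    [IsScalarTower K R M] {ℳ : ℕ → Submodule K M} (G : Grading 𝓡 ℳ) (h : IsFP R M 0) :
    IsGradedFP 𝓡 ℳ 0 := by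
  have := h.finite
  obtain ⟨r, deg, p, hp, hgp⟩ := G.exists_surjective
  exact ⟨fun _ => r, fun _ => deg, p, fun _ => 0, ⟨hp, by simp, by simp⟩, hgp, by simp⟩

/-- The hypothesis `ih` concerns only the universe of `R`, where the kernel of a free cover lies,
while `M` is in any universe. This step is therefore used both inside the induction and once more
after it. -/
theorem isGradedFP_succ (GR : Grading 𝓡 𝓡) {n : ℕ}
    (ih : ∀ (L : Type v) [AddCommGroup L] [Module K L] [Module R L] [IsScalarTower K R L]
      (ℒ : ℕ → Submodule K L), Grading 𝓡 ℒ → IsFP R L n → IsGradedFP 𝓡 ℒ n)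
    {M : Type w} [AddCommGroup M] [Module K M] [Module R M]
    [IsScalarTower K R M] {ℳ : ℕ → Submodule K M} (G : Grading 𝓡 ℳ) (h : IsFP R M (n + 1)) :
    IsGradedFP 𝓡 ℳ (n + 1) := by
  have := h.finite
  obtain ⟨r, deg, p, hp, hgp⟩ := G.exists_surjective
  exact isGradedFP_succ_of_ker hp hgp
    (ih _ _ ((GR.free deg).ker G hgp) ((isFP_succ_iff_ker p hp).1 h))

theorem isGradedFP (GR : Grading 𝓡 𝓡) {M : Type w} [AddCommGroup M] [Module K M] [Module R M]
    [IsScalarTower K R M] {ℳ : ℕ → Submodule K M} (G : Grading 𝓡 ℳ) {n : ℕ} (h : IsFP R M n) :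
    IsGradedFP 𝓡 ℳ n := by
  have aux : ∀ (n : ℕ) (L : Type v) [AddCommGroup L] [Module K L] [Module R L]
      [IsScalarTower K R L] (ℒ : ℕ → Submodule K L), Grading 𝓡 ℒ → IsFP R L n →
      IsGradedFP 𝓡 ℒ n := by
    intro n
    induction n with
    | zero => exact fun L _ _ _ _ ℒ G h => G.isGradedFP_zero h
    | succ n ih => exact fun L _ _ _ _ ℒ G h => isGradedFP_succ GR ih G h
  cases n with
  | zero => exact G.isGradedFP_zero h
  | succ n => exact isGradedFP_succ GR (aux n) G h

theorem _root_.HomFin.IsGradedFP.isFP {M : Type w} [AddCommGroup M] [Module K M] [Module R M]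
    {ℳ : ℕ → Submodule K M} {n : ℕ} (h : IsGradedFP 𝓡 ℳ n) : IsFP R M n := by
  obtain ⟨r, -, p, d, h, -⟩ := h
  exact ⟨r, p, d, h⟩

end FP

end Grading

/-! ### Graded base change along a surjection with kernel in positive degrees -/

section BaseChange

/-- For a ring homomorphism `φ : R → S` and a `B`-module `M`, the additive subgroup generated by
the `b • m` with `φ (b • 1) = 0`. -/
def kerSMul {R S : Type*} (B : Type*) [Ring R] [Ring S] [Ring B] [Module B R] (φ : R →+* S)
    (M : Type*) [AddCommGroup M] [Module B M] : AddSubgroup M :=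
  AddSubgroup.closure {x | ∃ (b : B) (m : M), φ (b • (1 : R)) = 0 ∧ x = b • m}

section

variable {R S B : Type*} [Ring R] [Ring S] [Ring B] [Module B R] {φ : R →+* S}
  {M N : Type*} [AddCommGroup M] [Module B M] [AddCommGroup N] [Module B N]

theorem smul_mem_kerSMul {b : B} (hb : φ (b • (1 : R)) = 0) (m : M) : b • m ∈ kerSMul B φ M :=
  AddSubgroup.subset_closure ⟨b, m, hb, rfl⟩

theorem map_mem_kerSMul (g : M →ₗ[B] N) {x : M} (hx : x ∈ kerSMul B φ M) :
    g x ∈ kerSMul B φ N := by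
  induction hx using AddSubgroup.closure_induction with
  | mem x hx =>
    obtain ⟨b, m, hb, rfl⟩ := hx
    rw [map_smul]
    exact smul_mem_kerSMul hb _
  | zero => simp
  | add x y _ _ hx hy => simpa using add_mem hx hy
  | neg x _ hx => simpa using hx

theorem exists_mem_kerSMul (g : M →ₗ[B] N) (hg : Function.Surjective g) {y : N}
    (hy : y ∈ kerSMul B φ N) : ∃ x ∈ kerSMul B φ M, g x = y := by
  induction hy using AddSubgroup.closure_induction with
  | mem y hy =>
    obtain ⟨b, n, hb, rfl⟩ := hy
    obtain ⟨m, rfl⟩ := hg n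
    exact ⟨b • m, smul_mem_kerSMul hb m, map_smul g b m⟩
  | zero => exact ⟨0, zero_mem _, map_zero g⟩
  | add x y _ _ hx hy =>
    obtain ⟨x', hx', rfl⟩ := hx
    obtain ⟨y', hy', rfl⟩ := hy
    exact ⟨x' + y', add_mem hx' hy', map_add g _ _⟩
  | neg x _ hx =>
    obtain ⟨x', hx', rfl⟩ := hx
    exact ⟨-x', neg_mem hx', map_neg g _⟩

theorem map_eq_zero_of_mem_kerSMul [Module R M] [IsScalarTower B R M] {N : Type*} [AddCommGroup N]
    [Module S N] (f : M →ₛₗ[φ] N) {x : M} (hx : x ∈ kerSMul B φ M) : f x = 0 := by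
  induction hx using AddSubgroup.closure_induction with
  | mem x hx =>
    obtain ⟨b, m, hb, rfl⟩ := hx
    rw [← one_smul R m, ← smul_assoc, map_smulₛₗ, hb, zero_smul]
  | zero => exact map_zero f
  | add x y _ _ hx hy => rw [map_add, hx, hy, add_zero]
  | neg x _ hx => rw [map_neg, hx, neg_zero]

theorem mem_kerSMul_pi {r : ℕ} {x : Fin r → M} (hx : ∀ l, x l ∈ kerSMul B φ M) :
    x ∈ kerSMul B φ (Fin r → M) := by
  rw [← Finset.univ_sum_single x]
  exact sum_mem fun l _ => map_mem_kerSMul (LinearMap.single B (fun _ => M) l) (hx l)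

end

theorem Grading.proj_smul {K R M : Type*} [CommRing K] [Ring R] [Algebra K R] [AddCommGroup M]
    [Module K M] [Module R M] {𝓡 : ℕ → Submodule K R} {ℳ : ℕ → Submodule K M}
    (GR : Grading 𝓡 𝓡) (G : Grading 𝓡 ℳ) (j : ℕ) (a : R) {d : ℕ} {m : M} (hm : m ∈ ℳ d) :
    G.proj j (a • m) = if d ≤ j then GR.proj (j - d) a • m else 0 := by
  induction a using GR.induction with
  | mem i a ha =>
    have ham := G.smul_mem ha hm
    by_cases h : i + d = j
    · subst h
      rw [G.proj_of_mem ham, if_pos (by omega), Nat.add_sub_cancel, GR.proj_of_mem ha]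
    · rw [G.proj_of_mem_ne ham h]
      split_ifs with hd
      · rw [GR.proj_of_mem_ne ha (by omega), zero_smul]
      · rfl
  | add a b ha hb =>
    rw [add_smul, map_add, ha, hb]
    split_ifs
    · rw [map_add, add_smul]
    · rw [add_zero]

variable {K : Type u} {R S : Type v} {B : Type w} [CommRing K] [Ring R] [Algebra K R] [Ring S]
  [Ring B] [Module B R] {𝓡 : ℕ → Submodule K R} {φ : R →+* S}

/-- The graded Nakayama lemma. -/
theorem Grading.span_eq_top_of_map {M : Type*} [AddCommGroup M] [Module K M] [Module R M]
    [Module B M] [IsScalarTower B R M] {ℳ : ℕ → Submodule K M} (GR : Grading 𝓡 𝓡)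
    (hpos : ∀ a, φ a = 0 → GR.proj 0 a = 0) (hφ : Function.Surjective φ)
    (G : Grading 𝓡 ℳ) {N : Type*} [AddCommGroup N] [Module S N] {f : M →ₛₗ[φ] N}
    (hf : ∀ x, f x = 0 → x ∈ kerSMul B φ M) {r : ℕ} {deg : Fin r → ℕ} {m : Fin r → M}
    (hm : ∀ l, m l ∈ ℳ (deg l)) (hspan : Submodule.span S (Set.range (f ∘ m)) = ⊤) :
    Submodule.span R (Set.range m) = ⊤ := by
  set P := Submodule.span R (Set.range m)
  have hmP : ∀ l, m l ∈ P := fun l => Submodule.subset_span ⟨l, rfl⟩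
  have key : ∀ j, ∀ x ∈ ℳ j, x ∈ P := by
    intro j
    induction j using Nat.strong_induction_on with
    | _ j ih =>
    intro x hx
    -- For `z` of degree `d`, the degree `j` part of `b • z` is the degree `j - d` part of `b • 1`
    -- times `z`. It vanishes for `d = j` by `hpos` and for `d > j` trivially; for `d < j`, the
    -- induction gives `z ∈ P`.
    have hker : ∀ y ∈ kerSMul B φ M, G.proj j y ∈ P := by
      intro y hy
      induction hy using AddSubgroup.closure_induction with
      | mem y hy =>
        obtain ⟨b, z, hb, rfl⟩ := hy
        induction z using G.induction with
        | mem d z hz =>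
          rw [← one_smul R z, ← smul_assoc, GR.proj_smul G j _ hz]
          split_ifs with hd
          · obtain rfl | hd := hd.eq_or_lt
            · rw [Nat.sub_self, hpos _ hb, zero_smul]
              exact zero_mem _
            · exact P.smul_mem _ (ih d hd z hz)
          · exact zero_mem _
        | add y z hy hz =>
          rw [smul_add, map_add]
          exact add_mem hy hz
      | zero => simp
      | add x y _ _ hx hy => simpa using add_mem hx hy
      | neg x _ hx => simpa using hx
    -- Modulo `kerSMul`, `x` is a combination of the `m l`, with coefficients lifted from `S`; then
    -- compare components of degree `j`.
    obtain ⟨c, hc⟩ := (Submodule.mem_span_range_iff_exists_fun S).1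
      (hspan ▸ Submodule.mem_top : f x ∈ Submodule.span S (Set.range (f ∘ m)))
    choose a ha using fun l => hφ (c l)
    have h₁ := hker (x - ∑ l, a l • m l) (hf _ (by simp [← hc, ha]))
    rw [map_sub, G.proj_of_mem hx, map_sum] at h₁
    refine (Submodule.sub_mem_iff_left _ (sum_mem fun l _ => ?_)).1 h₁
    rw [GR.proj_smul G j _ (hm l)]
    split_ifs
    · exact P.smul_mem _ (hmP l)
    · exact zero_mem _
  rw [eq_top_iff]
  rintro x -
  induction x using G.induction with
  | mem j x hx => exact key j x hx
  | add x y hx hy => exact add_mem hx hy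

theorem Grading.exists_generators {M : Type*} [AddCommGroup M] [Module K M] [Module R M]
    [Module B M] [IsScalarTower B R M] {ℳ : ℕ → Submodule K M} (GR : Grading 𝓡 𝓡)
    (hpos : ∀ a, φ a = 0 → GR.proj 0 a = 0) (hφ : Function.Surjective φ)
    (G : Grading 𝓡 ℳ) {N : Type*} [AddCommGroup N] [Module S N] [Module.Finite S N]
    {f : M →ₛₗ[φ] N} (hf : Function.Surjective f) (hkf : ∀ x, f x = 0 → x ∈ kerSMul B φ M) :
    ∃ (r : ℕ) (deg : Fin r → ℕ) (m : Fin r → M), (∀ l, m l ∈ ℳ (deg l)) ∧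
      Submodule.span R (Set.range m) = ⊤ ∧ Submodule.span S (Set.range (f ∘ m)) = ⊤ := by
  have : RingHomSurjective φ := ⟨hφ⟩
  have hspan : Submodule.span S (f '' {x | ∃ j, x ∈ ℳ j}) = ⊤ := by
    rw [← Submodule.map_span, G.span_homogeneous, Submodule.map_top, LinearMap.range_eq_top]
    exact hf
  obtain ⟨r, y, hy, hyspan⟩ := exists_fin_span_eq_top hspan
  choose m hm hmy using hy
  choose deg hdeg using hm
  obtain rfl : f ∘ m = y := funext hmy
  exact ⟨r, deg, m, hdeg, GR.span_eq_top_of_map hpos hφ G hkf hdeg hyspan, hyspan⟩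

/-- Let `φ : R → S` be a surjective homomorphism of rings, where `R` is graded and the kernel of `φ`
lies in positive degrees. If everything is projective over `B` and the kernel of `φ` is generated
by elements of `B`, then a graded module is of type `FP_n` if and only if its base change is. -/
theorem Grading.isFP_iff_of_surjective [IsScalarTower B R R] [Module.Projective B R]
    (GR : Grading 𝓡 𝓡)
    (hpos : ∀ a, φ a = 0 → GR.proj 0 a = 0) (hφ : Function.Surjective φ)
    (hker : ∀ a, φ a = 0 → a ∈ kerSMul B φ R) {M : Type v} [AddCommGroup M] [Module K M]
    [Module R M] [Module B M] [IsScalarTower K R M] [IsScalarTower B R M] [Module.Projective B M]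
    {ℳ : ℕ → Submodule K M} (G : Grading 𝓡 ℳ) {N : Type*} [AddCommGroup N]
    [Module S N] (f : M →ₛₗ[φ] N) (hf : Function.Surjective f)
    (hkf : ∀ x, f x = 0 → x ∈ kerSMul B φ M) (n : ℕ) : IsFP R M n ↔ IsFP S N n := by
  suffices H : ∀ n (M : Type v) [AddCommGroup M] [Module K M]
      [Module R M] [Module B M] [IsScalarTower K R M] [IsScalarTower B R M] [Module.Projective B M]
      (ℳ : ℕ → Submodule K M) (_ : Grading 𝓡 ℳ) (N : Type v) [AddCommGroup N]
      [Module S N] (f : M →ₛₗ[φ] N), Function.Surjective f →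
      (∀ x, f x = 0 → x ∈ kerSMul B φ M) → (IsFP R M n ↔ IsFP S N n) by
    have := small_of_surjective hf
    let e := (Shrink.linearEquiv.{v} S N).symm
    rw [isFP_congr e]
    exact H n M ℳ G _ (e.toLinearMap.comp f) (e.surjective.comp hf)
      fun x hx => hkf x (e.map_eq_zero_iff.1 hx)
  clear! M N
  intro n
  induction n with
  | zero =>
    intro M _ _ _ _ _ _ _ ℳ G N _ _ f hf hkf
    have : RingHomSurjective φ := ⟨hφ⟩
    rw [isFP_zero_iff, isFP_zero_iff]
    constructor
    · intro h
      exact Module.Finite.of_surjective f hf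
    · intro h
      obtain ⟨r, deg, m, -, hm, -⟩ := GR.exists_generators hpos hφ G hf hkf
      exact ⟨hm ▸ Submodule.fg_span (Set.finite_range m)⟩
  | succ n ih =>
    intro M _ _ _ _ _ _ _ ℳ G N _ _ f hf hkf
    have : RingHomSurjective φ := ⟨hφ⟩
    -- Either side forces `N` to be finite, so generators may be chosen simultaneously for `M` and
    -- `N`.
    by_cases hN : Module.Finite S N
    swap
    · refine iff_of_false (fun h => hN ?_) fun h => hN h.finite
      have := h.finite
      exact Module.Finite.of_surjective f hf
    obtain ⟨r, deg, m, hdeg, hm, hfm⟩ := GR.exists_generators hpos hφ G hf hkf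
    let p := Fintype.linearCombination R m
    let q := Fintype.linearCombination S (f ∘ m)
    have hp : Function.Surjective p := by
      rw [← LinearMap.range_eq_top, Fintype.range_linearCombination, hm]
    have hq : Function.Surjective q := by
      rw [← LinearMap.range_eq_top, Fintype.range_linearCombination, hfm]
    have hgp : IsGradedMap (freeGrading 𝓡 deg) ℳ p := G.isGradedMap_linearCombination hdeg
    have hpq : ∀ x : Fin r → R, q (φ ∘ x) = f (p x) := fun x => by
      simp [p, q, Fintype.linearCombination_apply]
    -- The cover `p` splits over `B`, giving a `B`-linear retraction `σ` onto its kernel. This makes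
    -- the kernel projective over `B` and takes the place of the vanishing of `Tor₁`.
    obtain ⟨s, hs⟩ := Module.projective_lifting_property (p.restrictScalars B) LinearMap.id hp
    have hs' : ∀ y, p (s y) = y := fun y => LinearMap.congr_fun hs y
    let σ : (Fin r → R) →ₗ[B] LinearMap.ker p :=
      (LinearMap.id - s ∘ₗ p.restrictScalars B).codRestrict
        ((LinearMap.ker p).restrictScalars B) fun x => by simp [hs']
    have hσ : ∀ x : LinearMap.ker p, σ x = x := fun x => Subtype.ext <| by
      have : p x = 0 := x.2
      change (x : Fin r → R) - s (p x) = x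
      rw [this, map_zero, sub_zero]
    have : Module.Projective B (Fin r → R) :=
      .of_equiv' (DFinsupp.linearEquivFunOnFintype (R := B) (M := fun _ : Fin r => R))
    have : Module.Projective B (LinearMap.ker p) :=
      .of_split ((LinearMap.ker p).subtype.restrictScalars B) σ (LinearMap.ext hσ)
    let g : LinearMap.ker p →ₛₗ[φ] LinearMap.ker q :=
      { toFun := fun x => ⟨φ ∘ x.1, by
          rw [LinearMap.mem_ker, hpq, show p x.1 = 0 from x.2, map_zero]⟩
        map_add' := fun x y => Subtype.ext (funext fun l => map_add φ (x.1 l) (y.1 l))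
        map_smul' := fun a x => Subtype.ext (funext fun l => map_mul φ a (x.1 l)) }
    rw [isFP_succ_iff_ker p hp, isFP_succ_iff_ker q hq]
    refine ih _ _ ((GR.free deg).ker G hgp) _ g ?_ ?_
    · rintro ⟨y, hy⟩
      choose x hx using fun l => hφ (y l)
      obtain rfl : φ ∘ x = y := funext hx
      have h₀ : f (p x) = 0 := by rw [← hpq]; exact hy
      -- A lift `x` of `y` need not lie in `ker p`, but `p x` lies in `kerSMul`; subtracting `x'`
      -- corrects this without changing the image under `φ`.
      obtain ⟨x', hx', hpx⟩ := exists_mem_kerSMul (p.restrictScalars B) hp (hkf _ h₀)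
      have hpx : p x' = p x := hpx
      refine ⟨⟨x - x', by rw [LinearMap.mem_ker, map_sub, hpx, sub_self]⟩,
        Subtype.ext (funext fun l => ?_)⟩
      have h₁ : φ (x' l) = 0 := map_eq_zero_of_mem_kerSMul φ.toSemilinearMap
        (map_mem_kerSMul (LinearMap.proj (φ := fun _ => R) l) hx')
      change φ (x l - x' l) = φ (x l)
      rw [map_sub, h₁, sub_zero]
    · intro x hx
      have hx : φ ∘ x.1 = 0 := congrArg Subtype.val hx
      -- The coordinates of `x` lie in `kerSMul`, so `x` does as an element of the free module; the
      -- `B`-linear `σ` carries this over to `ker p`.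
      rw [← hσ x]
      exact map_mem_kerSMul σ (mem_kerSMul_pi fun l => hker _ (congrFun hx l))

end BaseChange

/-! ### Gradings of the opposite and enveloping algebras, of bimodules and of the ground field -/

section Gradings

variable {K : Type u} {A : Type v} [Field K] [Ring A] [Algebra K A]

/-- The grading of a graded algebra, as a module over itself. -/
def Grading.ofGradedAlgebra (𝒜 : ℕ → Submodule K A) [GradedAlgebra 𝒜] : Grading 𝒜 𝒜 where
  smul_mem ha hx := SetLike.mul_mem_graded ha hx
  proj j := GradedAlgebra.proj 𝒜 j
  proj_of_mem hx := DirectSum.decompose_of_mem_same 𝒜 hx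
  proj_of_mem_ne hx h := DirectSum.decompose_of_mem_ne 𝒜 hx h
  iSup_eq_top := (DirectSum.Decomposition.isInternal 𝒜).submodule_iSup_eq_top

variable {𝒜 : ℕ → Submodule K A}

theorem mem_opGrading {i : ℕ} {x : Aᵐᵒᵖ} : x ∈ opGrading 𝒜 i ↔ x.unop ∈ 𝒜 i :=
  ⟨by rintro ⟨a, ha, rfl⟩; exact ha, fun h => ⟨_, h, rfl⟩⟩

/-- The grading of the opposite algebra, as a module over itself. -/
def Grading.op (G : Grading 𝒜 𝒜) : Grading (opGrading 𝒜) (opGrading 𝒜) where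
  smul_mem {i j a x} ha hx := by
    rw [mem_opGrading] at *
    rw [add_comm]
    exact G.smul_mem hx ha
  proj j := (MulOpposite.opLinearEquiv K).toLinearMap ∘ₗ G.proj j ∘ₗ
    (MulOpposite.opLinearEquiv K).symm.toLinearMap
  proj_of_mem hx := MulOpposite.unop_injective (G.proj_of_mem (mem_opGrading.1 hx))
  proj_of_mem_ne hx h := MulOpposite.unop_injective (G.proj_of_mem_ne (mem_opGrading.1 hx) h)
  iSup_eq_top := by
    have : (⨆ j, opGrading 𝒜 j) =
        (⨆ j, 𝒜 j).map (MulOpposite.opLinearEquiv K).toLinearMap := by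
      rw [Submodule.map_iSup]
      rfl
    rw [this, G.iSup_eq_top, Submodule.map_top, LinearEquiv.range]

theorem tmul_mem_envGrading {p q i : ℕ} (h : p + q = i) {a : A} {b : Aᵐᵒᵖ} (ha : a ∈ 𝒜 p)
    (hb : b ∈ opGrading 𝒜 q) : a ⊗ₜ[K] b ∈ envGrading 𝒜 i :=
  Submodule.subset_span ⟨p, q, h, a, ha, b.unop, mem_opGrading.1 hb, rfl⟩

theorem envGrading_induction {i : ℕ} {motive : (x : A ⊗[K] Aᵐᵒᵖ) → x ∈ envGrading 𝒜 i → Prop}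
    (tmul : ∀ p q (h : p + q = i) a (ha : a ∈ 𝒜 p) b (hb : b ∈ opGrading 𝒜 q),
      motive (a ⊗ₜ b) (tmul_mem_envGrading h ha hb))
    (zero : motive 0 (zero_mem _))
    (add : ∀ x y hx hy, motive x hx → motive y hy → motive (x + y) (add_mem hx hy))
    {x : A ⊗[K] Aᵐᵒᵖ} (hx : x ∈ envGrading 𝒜 i) : motive x hx := by
  induction hx using Submodule.closure_induction with
  | zero => exact zero
  | add x y _ _ hx hy => exact add x y _ _ hx hy
  | smul_mem c x hx =>
    obtain ⟨p, q, h, a, ha, b, hb, rfl⟩ := hx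
    exact tmul p q h _ ((𝒜 p).smul_mem c ha) _ (mem_opGrading.2 hb)

/-- The projections of the enveloping algebra onto its homogeneous components. -/
noncomputable def Grading.envProj (G : Grading 𝒜 𝒜) (j : ℕ) : A ⊗[K] Aᵐᵒᵖ →ₗ[K] A ⊗[K] Aᵐᵒᵖ :=
  ∑ x ∈ Finset.HasAntidiagonal.antidiagonal j, TensorProduct.map (G.proj x.1) (G.op.proj x.2)

theorem Grading.envProj_tmul (G : Grading 𝒜 𝒜) {p q : ℕ} {a : A} {b : Aᵐᵒᵖ} (ha : a ∈ 𝒜 p)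
    (hb : b ∈ opGrading 𝒜 q) (j : ℕ) :
    G.envProj j (a ⊗ₜ b) = if p + q = j then a ⊗ₜ b else 0 := by
  have h0 : ∀ x : ℕ × ℕ, x ≠ (p, q) →
      (TensorProduct.map (G.proj x.1) (G.op.proj x.2)) (a ⊗ₜ[K] b) = 0 := by
    rintro ⟨p', q'⟩ hx
    rw [TensorProduct.map_tmul]
    by_cases hp : p = p'
    · rw [G.op.proj_of_mem_ne hb (j := q') (by rintro rfl; exact hx (by rw [hp])),
        TensorProduct.tmul_zero]
    · rw [G.proj_of_mem_ne ha hp, TensorProduct.zero_tmul]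
  rw [envProj, LinearMap.sum_apply]
  split_ifs with h
  · rw [Finset.sum_eq_single_of_mem (p, q) (Finset.HasAntidiagonal.mem_antidiagonal.2 h) fun x _ hx => h0 x hx,
      TensorProduct.map_tmul, G.proj_of_mem ha, G.op.proj_of_mem hb]
  · exact Finset.sum_eq_zero fun x hx => h0 x <| by
      rintro rfl
      exact h (Finset.HasAntidiagonal.mem_antidiagonal.1 hx)

/-- The grading of the enveloping algebra, as a module over itself. -/
noncomputable def Grading.env (G : Grading 𝒜 𝒜) : Grading (envGrading 𝒜) (envGrading 𝒜) where
  smul_mem {i j x y} hx hy := by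
    induction hx using envGrading_induction with
    | zero => simp
    | add x x' _ _ hx hx' => simpa only [add_smul] using add_mem hx hx'
    | tmul p q h a ha b hb =>
      induction hy using envGrading_induction with
      | zero => simp
      | add y y' _ _ hy hy' => simpa only [smul_add] using add_mem hy hy'
      | tmul p' q' h' a' ha' b' hb' =>
        rw [smul_eq_mul, Algebra.TensorProduct.tmul_mul_tmul]
        exact tmul_mem_envGrading (by omega) (G.smul_mem ha ha') (G.op.smul_mem hb hb')
  proj := G.envProj
  proj_of_mem {j x} hx := by
    induction hx using envGrading_induction with
    | zero => simp
    | add x y _ _ hx hy => rw [map_add, hx, hy]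
    | tmul p q h a ha b hb => rw [G.envProj_tmul ha hb, if_pos h]
  proj_of_mem_ne {i j x} hx hij := by
    induction hx using envGrading_induction with
    | zero => simp
    | add x y _ _ hx hy => rw [map_add, hx, hy, add_zero]
    | tmul p q h a ha b hb => rw [G.envProj_tmul ha hb, if_neg (h ▸ hij)]
  iSup_eq_top := by
    rw [eq_top_iff]
    rintro x -
    induction x with
    | zero => exact zero_mem _
    | add x y hx hy => exact add_mem hx hy
    | tmul a b =>
      induction a using G.induction with
      | add a a' ha ha' => simpa only [TensorProduct.add_tmul] using add_mem ha ha'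
      | mem p a ha =>
        induction b using G.op.induction with
        | add b b' hb hb' => simpa only [TensorProduct.tmul_add] using add_mem hb hb'
        | mem q b hb => exact Submodule.mem_iSup_of_mem (p + q) (tmul_mem_envGrading rfl ha hb)

/-- A graded algebra as a graded module over its enveloping algebra, for some bimodule structure. -/
def Grading.bimodule (G : Grading 𝒜 𝒜) [Module (A ⊗[K] Aᵐᵒᵖ) A]
    (h : ∀ p q j, ∀ a ∈ 𝒜 p, ∀ b ∈ opGrading 𝒜 q, ∀ x ∈ 𝒜 j,
      (a ⊗ₜ[K] b) • x ∈ 𝒜 (p + q + j)) : Grading (envGrading 𝒜) 𝒜 where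
  smul_mem {i j r x} hr hx := by
    induction hr using envGrading_induction with
    | zero => exact (zero_smul (A ⊗[K] Aᵐᵒᵖ) x).symm ▸ zero_mem _
    | add r r' _ _ hr hr' => simpa only [add_smul] using add_mem hr hr'
    | tmul p q hpq a ha b hb => exact hpq ▸ h p q j a ha b hb x hx
  proj := G.proj
  proj_of_mem := G.proj_of_mem
  proj_of_mem_ne := G.proj_of_mem_ne
  iSup_eq_top := G.iSup_eq_top

/-- The grading of the ground field, as a module via a graded augmentation. -/
noncomputable def groundGradingOf {R : Type*} [Ring R] [Algebra K R] {𝓡 : ℕ → Submodule K R}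
    (η : R →ₐ[K] K) (hη : ∀ i, 0 < i → ∀ a ∈ 𝓡 i, η a = 0) :
    letI := leftModule η
    Grading 𝓡 (groundGrading K) :=
  letI := leftModule η
  { smul_mem := fun {i j a x} ha hx => by
      change η a * x ∈ _
      rcases Nat.eq_zero_or_pos i with rfl | hi
      · rw [zero_add]
        exact (groundGrading K j).smul_mem _ hx
      · rw [hη i hi a ha, zero_mul]
        exact zero_mem _
    proj := fun j => if j = 0 then LinearMap.id else 0
    proj_of_mem := fun {j x} hx => by
      unfold groundGrading at hx
      split_ifs at hx ⊢
      · rfl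
      · exact ((Submodule.mem_bot K).1 hx).symm
    proj_of_mem_ne := fun {i j x} hx hij => by
      unfold groundGrading at hx
      split_ifs at hx ⊢ with h₁ h₂
      · exact absurd (h₂.trans h₁.symm) hij
      · exact (Submodule.mem_bot K).1 hx
      · rfl
      · rfl
    iSup_eq_top := eq_top_iff.2 <| le_iSup_of_le 0 (by simp [groundGrading]) }

end Gradings

/-! ### The enveloping algebra over its two factors -/

section Projective

variable {K A B : Type*} [Field K] [Ring A] [Algebra K A] [Ring B] [Algebra K B]

theorem projective_includeLeft :
    letI := Module.compHom (A ⊗[K] B)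
      (Algebra.TensorProduct.includeLeft : A →ₐ[K] A ⊗[K] B).toRingHom
    Module.Projective A (A ⊗[K] B) := by
  have : Module.compHom (A ⊗[K] B)
      (Algebra.TensorProduct.includeLeft : A →ₐ[K] A ⊗[K] B).toRingHom =
      TensorProduct.leftModule := by
    refine Module.ext' _ _ fun a x => ?_
    change (a ⊗ₜ[K] (1 : B)) * x = a • x
    induction x with
    | zero => simp
    | add x y hx hy => rw [mul_add, hx, hy, smul_add]
    | tmul x y => simp [TensorProduct.smul_tmul']
  rw [this]
  infer_instance

theorem projective_includeRight :
    letI := Module.compHom (A ⊗[K] B)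
      (Algebra.TensorProduct.includeRight : B →ₐ[K] A ⊗[K] B).toRingHom
    Module.Projective B (A ⊗[K] B) := by
  let := Module.compHom (A ⊗[K] B)
    (Algebra.TensorProduct.includeRight : B →ₐ[K] A ⊗[K] B).toRingHom
  let e : B ⊗[K] A ≃ₗ[B] A ⊗[K] B :=
    { (TensorProduct.comm K B A).toAddEquiv with
      map_smul' := fun b x => by
        change TensorProduct.comm K B A (b • x) = ((1 : A) ⊗ₜ[K] b) * TensorProduct.comm K B A x
        induction x with
        | zero => simp
        | add x y hx hy => rw [smul_add, map_add, hx, hy, map_add, mul_add]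
        | tmul x y => simp [TensorProduct.smul_tmul'] }
  exact .of_equiv' e

end Projective

/-! ### Killing one of two commuting actions -/

section OneSided

variable {K : Type u} {R A : Type v} {B : Type w} [Field K] [Ring R] [Algebra K R]
  [Ring A] [Algebra K A] [Ring B] [Algebra K B] {𝓡 : ℕ → Submodule K R}

/-- Let `R` be spanned by the products of commuting images of `A` and `B`, where `B` is augmented,
and let `φ : R → A` be the induced homomorphism. A graded `R`-module which is free of rank one
over `B` is of type `FP_n` if and only if the ground field is of type `FP_n` over `A`. -/
theorem Grading.isFP_iff_of_equiv (GR : Grading 𝓡 𝓡) (ε : A →ₐ[K] K) (δ : B →ₐ[K] K)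
    (α : A →ₐ[K] R) (β : B →ₐ[K] R) (φ : R →ₐ[K] A) (hcomm : ∀ a b, Commute (α a) (β b))
    (hαβ : ∀ r, r ∈ AddSubmonoid.closure {r | ∃ a b, r = α a * β b})
    (hφα : ∀ a, φ (α a) = a) (hφβ : ∀ b, φ (β b) = algebraMap K A (δ b))
    (hproj : ∀ r, GR.proj 0 r = algebraMap K R (ε (φ r)))
    (hR : letI := Module.compHom R β.toRingHom; Module.Projective B R)
    {M : Type v} [AddCommGroup M] [Module K M] [Module R M] [IsScalarTower K R M]
    {ℳ : ℕ → Submodule K M} (G : Grading 𝓡 ℳ) (e : B ≃+ M) (he : ∀ b b', e (b * b') = β b • e b')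
    (f : M →+ K) (hf : ∀ r m, f (r • m) = ε (φ r) * f m) (hfe : ∀ b, f (e b) = δ b) (n : ℕ) :
    IsFP R M n ↔ letI := leftModule ε; IsFP A K n := by
  let := leftModule ε
  let : Module B R := Module.compHom R β.toRingHom
  let : Module B M := Module.compHom M β.toRingHom
  have hBR : ∀ (b : B) (r : R), b • r = β b * r := fun _ _ => rfl
  have hBM : ∀ (b : B) (m : M), b • m = β b • m := fun _ _ => rfl
  have : IsScalarTower B R R := ⟨fun b r s => mul_assoc (β b) r s⟩
  have : IsScalarTower B R M := ⟨fun b r m => mul_smul (β b) r m⟩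
  have : Module.Projective B M := .of_equiv' { e with map_smul' := he }
  have hδ : ∀ b : B, φ (b • (1 : R)) = algebraMap K A (δ b) := fun b => by
    rw [hBR, mul_one, hφβ]
  let f' : M →ₛₗ[φ.toRingHom] K := { f with map_smul' := hf }
  refine GR.isFP_iff_of_surjective (B := B) (φ := φ.toRingHom) (fun r hr => ?_)
    (fun a => ⟨α a, hφα a⟩) (fun r hr => ?_) G f' (fun c => ?_) (fun x hx => ?_) n
  · have hr : φ r = 0 := hr
    rw [hproj, hr, map_zero, map_zero]
  · replace hr : φ r = 0 := hr
    -- On a product `α a * β b` this difference is `(b - δ b) • α a`, and `b - δ b` is killed by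
    -- `δ`. Additivity does the rest.
    suffices r - α (φ r) ∈ kerSMul B φ.toRingHom R by
      rwa [hr, map_zero, sub_zero] at this
    clear hr
    induction hαβ r using AddSubmonoid.closure_induction with
    | mem r hr =>
      obtain ⟨a, b, rfl⟩ := hr
      have : α a * β b - α (φ (α a * β b)) = (b - algebraMap K B (δ b)) • α a := by
        rw [hBR, map_mul, hφα, hφβ, map_mul, AlgHom.commutes, map_sub, AlgHom.commutes, sub_mul,
          (hcomm a b).eq, Algebra.commutes]
      rw [this]
      refine smul_mem_kerSMul ?_ _
      exact (hδ _).trans (by simp)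
    | zero => simp
    | add x y _ _ hx hy =>
      rw [map_add, map_add, add_sub_add_comm]
      exact add_mem hx hy
  · refine ⟨e (algebraMap K B c), ?_⟩
    exact (hfe _).trans (by simp)
  · obtain ⟨b, rfl⟩ := e.surjective x
    have hb : δ b = 0 := (hfe b).symm.trans hx
    have : e b = b • e 1 := by rw [hBM, ← he, mul_one]
    rw [this]
    exact smul_mem_kerSMul ((hδ b).trans (by rw [hb, map_zero])) _

end OneSided

/-! ### Comparison of the four ungraded properties -/

section Enveloping

variable {K : Type u} {A : Type v} [Field K] [Ring A] [Algebra K A]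

/-- The homomorphism `a ⊗ op b ↦ a * ε b`. -/
noncomputable def envToLeft (ε : A →ₐ[K] K) : A ⊗[K] Aᵐᵒᵖ →ₐ[K] A :=
  Algebra.TensorProduct.lift (AlgHom.id K A) ((Algebra.ofId K A).comp (opAugmentation ε))
    fun a b => (Algebra.commutes (opAugmentation ε b) a).symm

/-- The homomorphism `a ⊗ op b ↦ op b * ε a`. -/
noncomputable def envToRight (ε : A →ₐ[K] K) : A ⊗[K] Aᵐᵒᵖ →ₐ[K] Aᵐᵒᵖ :=
  Algebra.TensorProduct.lift ((Algebra.ofId K Aᵐᵒᵖ).comp ε) (AlgHom.id K Aᵐᵒᵖ)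
    fun a b => Algebra.commutes (ε a) b

theorem envToLeft_tmul (ε : A →ₐ[K] K) (a : A) (b : Aᵐᵒᵖ) :
    envToLeft ε (a ⊗ₜ b) = a * algebraMap K A (opAugmentation ε b) :=
  Algebra.TensorProduct.lift_tmul _ _ _ a b

theorem envToRight_tmul (ε : A →ₐ[K] K) (a : A) (b : Aᵐᵒᵖ) :
    envToRight ε (a ⊗ₜ b) = algebraMap K Aᵐᵒᵖ (ε a) * b :=
  Algebra.TensorProduct.lift_tmul _ _ _ a b

theorem augmentation_envToLeft (ε : A →ₐ[K] K) (r : A ⊗[K] Aᵐᵒᵖ) :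
    ε (envToLeft ε r) = envAugmentation ε r := by
  induction r with
  | zero => simp
  | add x y hx hy => simp [hx, hy]
  | tmul a b => simp [envToLeft_tmul, envAugmentation]

theorem opAugmentation_envToRight (ε : A →ₐ[K] K) (r : A ⊗[K] Aᵐᵒᵖ) :
    opAugmentation ε (envToRight ε r) = envAugmentation ε r := by
  induction r with
  | zero => simp
  | add x y hx hy => simp [hx, hy]
  | tmul a b =>
    rw [envToRight_tmul, map_mul, AlgHom.commutes]
    exact (envAugmentation_tmul ε a b.unop).symm

theorem mem_closure_left (r : A ⊗[K] Aᵐᵒᵖ) :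
    r ∈ AddSubmonoid.closure {r | ∃ (a : A) (b : Aᵐᵒᵖ),
      r = (Algebra.TensorProduct.includeLeft : A →ₐ[K] A ⊗[K] Aᵐᵒᵖ) a *
        (Algebra.TensorProduct.includeRight : Aᵐᵒᵖ →ₐ[K] A ⊗[K] Aᵐᵒᵖ) b} := by
  induction r with
  | zero => exact zero_mem _
  | add x y hx hy => exact add_mem hx hy
  | tmul a b => exact AddSubmonoid.subset_closure ⟨a, b, by simp⟩

theorem mem_closure_right (r : A ⊗[K] Aᵐᵒᵖ) :
    r ∈ AddSubmonoid.closure {r | ∃ (b : Aᵐᵒᵖ) (a : A),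
      r = (Algebra.TensorProduct.includeRight : Aᵐᵒᵖ →ₐ[K] A ⊗[K] Aᵐᵒᵖ) b *
        (Algebra.TensorProduct.includeLeft : A →ₐ[K] A ⊗[K] Aᵐᵒᵖ) a} := by
  induction r with
  | zero => exact zero_mem _
  | add x y hx hy => exact add_mem hx hy
  | tmul a b => exact AddSubmonoid.subset_closure ⟨b, a, by simp⟩

theorem commute_include (a : A) (b : Aᵐᵒᵖ) :
    Commute ((Algebra.TensorProduct.includeLeft : A →ₐ[K] A ⊗[K] Aᵐᵒᵖ) a)
      ((Algebra.TensorProduct.includeRight : Aᵐᵒᵖ →ₐ[K] A ⊗[K] Aᵐᵒᵖ) b) := by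
  simp [Commute, SemiconjBy]

variable {𝒜 : ℕ → Submodule K A}

theorem envAugmentation_eq_zero_of_mem {ε : A →ₐ[K] K}
    (hε : ∀ i, 0 < i → ∀ a ∈ 𝒜 i, ε a = 0) (i : ℕ) (hi : 0 < i) (r : A ⊗[K] Aᵐᵒᵖ)
    (hr : r ∈ envGrading 𝒜 i) : envAugmentation ε r = 0 := by
  induction hr using envGrading_induction with
  | zero => exact map_zero _
  | add x y _ _ hx hy => rw [map_add, hx, hy, add_zero]
  | tmul p q h a ha b hb =>
    change envAugmentation ε (a ⊗ₜ[K] MulOpposite.op b.unop) = 0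
    rw [envAugmentation_tmul]
    rcases Nat.eq_zero_or_pos p with rfl | hp
    · rw [hε q (by omega) _ (mem_opGrading.1 hb), mul_zero]
    · rw [hε p hp a ha, zero_mul]

/-- Provides the condition `hproj` of `Grading.isFP_iff_of_equiv`, by which `envToLeft ε` and
`envToRight ε` have kernels in positive degrees. -/
theorem Grading.env_proj_zero (G : Grading 𝒜 𝒜) {ε : A →ₐ[K] K}
    (hG : ∀ a, G.proj 0 a = algebraMap K A (ε a)) (r : A ⊗[K] Aᵐᵒᵖ) :
    G.env.proj 0 r = algebraMap K (A ⊗[K] Aᵐᵒᵖ) (envAugmentation ε r) := by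
  induction r with
  | zero => simp
  | add x y hx hy => simp only [map_add, hx, hy]
  | tmul a b =>
    have hb : G.op.proj 0 b = algebraMap K Aᵐᵒᵖ (opAugmentation ε b) :=
      congrArg MulOpposite.op (hG b.unop)
    change G.envProj 0 (a ⊗ₜ b) = _
    simp only [Grading.envProj, Finset.HasAntidiagonal.antidiagonal_zero, Finset.sum_singleton,
      TensorProduct.map_tmul, hG, hb]
    rw [show envAugmentation ε (a ⊗ₜ b) = ε a * opAugmentation ε b from
        envAugmentation_tmul ε a b.unop, map_mul, Algebra.TensorProduct.algebraMap_apply,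
      Algebra.TensorProduct.algebraMap_apply', Algebra.TensorProduct.tmul_mul_tmul, mul_one,
      one_mul]

variable (K A) in
theorem isScalarTower_selfBimodule :
    letI := selfBimodule K A
    IsScalarTower K (A ⊗[K] Aᵐᵒᵖ) A := by
  let := selfBimodule K A
  refine ⟨fun c r m => ?_⟩
  induction r with
  | zero =>
    have h := zero_smul (A ⊗[K] Aᵐᵒᵖ) m
    rw [smul_zero]
    exact h.trans ((congrArg (c • ·) h).trans (smul_zero c)).symm
  | add x y hx hy => rw [smul_add, add_smul, hx, hy, add_smul, smul_add]
  | tmul a b =>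
    rw [TensorProduct.smul_tmul']
    exact (selfBimodule_smul (K := K) (c • a) b.unop m).trans <| by
      rw [smul_mul_assoc, smul_mul_assoc, ← selfBimodule_smul (K := K) a b.unop m]
      rfl

theorem isScalarTower_compHom {R S M : Type*} [Ring R] [Algebra K R] [Ring S] [Algebra K S]
    [AddCommGroup M] [Module K M] [Module S M] [IsScalarTower K S M] (φ : R →ₐ[K] S) :
    letI := Module.compHom M φ.toRingHom
    IsScalarTower K R M := by
  let := Module.compHom M φ.toRingHom
  refine ⟨fun c r m => ?_⟩
  change φ (c • r) • m = c • φ r • m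
  rw [map_smul, smul_assoc]

/-- A graded algebra is a graded bimodule over itself. -/
noncomputable def Grading.self (G : Grading 𝒜 𝒜) :
    letI := selfBimodule K A
    Grading (envGrading 𝒜) 𝒜 :=
  letI := selfBimodule K A
  letI := isScalarTower_selfBimodule K A
  G.bimodule fun p q j a ha b hb x hx => by
    rw [show (a ⊗ₜ[K] b) • x = a * x * b.unop from selfBimodule_smul a b.unop x,
      show p + q + j = q + (p + j) by omega, add_comm q]
    exact G.op.smul_mem (x := MulOpposite.op (a * x)) hb (mem_opGrading.2 (G.smul_mem ha hx))
      |> fun h => by simpa [add_comm, mem_opGrading] using h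

/-- A graded algebra is a graded bimodule when the right action is trivial. -/
noncomputable def Grading.trivialRight (G : Grading 𝒜 𝒜) {ε : A →ₐ[K] K}
    (hε : ∀ i, 0 < i → ∀ a ∈ 𝒜 i, ε a = 0) :
    letI := Module.compHom A (envToLeft ε).toRingHom
    Grading (envGrading 𝒜) 𝒜 :=
  letI := Module.compHom A (envToLeft ε).toRingHom
  letI := isScalarTower_compHom (M := A) (envToLeft ε)
  G.bimodule fun p q j a ha b hb x hx => by
    change envToLeft ε (a ⊗ₜ b) * x ∈ _
    rw [envToLeft_tmul]
    rcases Nat.eq_zero_or_pos q with rfl | hq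
    · rw [← Algebra.commutes, mul_assoc, ← Algebra.smul_def]
      exact Submodule.smul_mem _ _ (G.smul_mem ha hx)
    · rw [show opAugmentation ε b = 0 from hε q hq _ (mem_opGrading.1 hb), map_zero, mul_zero,
        zero_mul]
      exact zero_mem _

/-- The bimodule `A` is free of rank one over the right factor, and killing the right action leaves
the left module `K`. -/
theorem Grading.biFP_iff_leftFP (G : Grading 𝒜 𝒜) {ε : A →ₐ[K] K}
    (hG : ∀ a, G.proj 0 a = algebraMap K A (ε a)) (n : ℕ) : BiFP K A n ↔ LeftFP ε n := by
  let := selfBimodule K A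
  have := isScalarTower_selfBimodule K A
  have hsmul : ∀ (a : A) (b : Aᵐᵒᵖ) (m : A), (a ⊗ₜ[K] b) • m = a * m * b.unop :=
    fun a b m => selfBimodule_smul a b.unop m
  refine G.env.isFP_iff_of_equiv ε (opAugmentation ε) Algebra.TensorProduct.includeLeft
    Algebra.TensorProduct.includeRight (envToLeft ε) commute_include mem_closure_left
    (fun a => ?_) (fun b => ?_) (fun r => ?_) projective_includeRight G.self
    MulOpposite.opAddEquiv.symm (fun b b' => ?_) (ε : A →+ K) (fun r m => ?_) (fun b => rfl) n
  · simp [envToLeft_tmul]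
  · simp [envToLeft_tmul]
  · rw [augmentation_envToLeft, G.env_proj_zero hG]
  · simp [hsmul]
  · rw [augmentation_envToLeft]
    induction r with
    | zero => exact (congrArg ε (zero_smul (A ⊗[K] Aᵐᵒᵖ) m)).trans (by simp)
    | add x y hx hy => rw [add_smul, map_add, hx, hy, map_add, add_mul]
    | tmul a b =>
      rw [hsmul]
      change ε _ = envAugmentation ε (a ⊗ₜ[K] MulOpposite.op b.unop) * ε m
      rw [envAugmentation_tmul, map_mul, map_mul]
      ring

theorem Grading.biFP_iff_rightFP (G : Grading 𝒜 𝒜) {ε : A →ₐ[K] K}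
    (hG : ∀ a, G.proj 0 a = algebraMap K A (ε a)) (n : ℕ) : BiFP K A n ↔ RightFP ε n := by
  let := selfBimodule K A
  have := isScalarTower_selfBimodule K A
  have hsmul : ∀ (a : A) (b : Aᵐᵒᵖ) (m : A), (a ⊗ₜ[K] b) • m = a * m * b.unop :=
    fun a b m => selfBimodule_smul a b.unop m
  refine G.env.isFP_iff_of_equiv (opAugmentation ε) ε Algebra.TensorProduct.includeRight
    Algebra.TensorProduct.includeLeft (envToRight ε) (fun b a => (commute_include a b).symm)
    mem_closure_right
    (fun a => ?_) (fun b => ?_) (fun r => ?_) projective_includeLeft G.self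
    (AddEquiv.refl A) (fun b b' => ?_) (ε : A →+ K) (fun r m => ?_) (fun b => rfl) n
  · simp [envToRight_tmul]
  · simp [envToRight_tmul]
  · rw [opAugmentation_envToRight, G.env_proj_zero hG]
  · simp [hsmul]
  · rw [opAugmentation_envToRight]
    induction r with
    | zero => exact (congrArg ε (zero_smul (A ⊗[K] Aᵐᵒᵖ) m)).trans (by simp)
    | add x y hx hy => rw [add_smul, map_add, hx, hy, map_add, add_mul]
    | tmul a b =>
      rw [hsmul]
      change ε _ = envAugmentation ε (a ⊗ₜ[K] MulOpposite.op b.unop) * ε m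
      rw [envAugmentation_tmul, map_mul, map_mul]
      ring

/-- Here the bimodule is free of rank one over the left factor. Killing the left action leaves `K`
as a right module. -/
theorem Grading.isFP_trivialRight_iff_rightFP (G : Grading 𝒜 𝒜) {ε : A →ₐ[K] K}
    (hG : ∀ a, G.proj 0 a = algebraMap K A (ε a))
    (hε : ∀ i, 0 < i → ∀ a ∈ 𝒜 i, ε a = 0) (n : ℕ) :
    (letI := Module.compHom A (envToLeft ε).toRingHom; IsFP (A ⊗[K] Aᵐᵒᵖ) A n) ↔
      RightFP ε n := by
  let := Module.compHom A (envToLeft ε).toRingHom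
  have := isScalarTower_compHom (M := A) (envToLeft ε)
  have hsmul : ∀ (r : A ⊗[K] Aᵐᵒᵖ) (m : A), r • m = envToLeft ε r * m := fun _ _ => rfl
  refine G.env.isFP_iff_of_equiv (opAugmentation ε) ε Algebra.TensorProduct.includeRight
    Algebra.TensorProduct.includeLeft (envToRight ε) (fun b a => (commute_include a b).symm)
    mem_closure_right
    (fun a => ?_) (fun b => ?_) (fun r => ?_) projective_includeLeft (G.trivialRight hε)
    (AddEquiv.refl A) (fun b b' => ?_) (ε : A →+ K) (fun r m => ?_) (fun b => rfl) n
  · simp [envToRight_tmul]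
  · simp [envToRight_tmul]
  · rw [opAugmentation_envToRight, G.env_proj_zero hG]
  · simp [hsmul, envToLeft_tmul]
  · rw [opAugmentation_envToRight, hsmul, ← augmentation_envToLeft]
    exact map_mul ε _ _

theorem Grading.weakBiFP_iff_leftFP (G : Grading 𝒜 𝒜) {ε : A →ₐ[K] K}
    (hG : ∀ a, G.proj 0 a = algebraMap K A (ε a))
    (hε : ∀ i, 0 < i → ∀ a ∈ 𝒜 i, ε a = 0) (n : ℕ) :
    WeakBiFP ε n ↔ LeftFP ε n := by
  let : Module A K := leftModule ε
  let : Module (A ⊗[K] Aᵐᵒᵖ) K := biModule ε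
  let : Module (A ⊗[K] Aᵐᵒᵖ) A := Module.compHom A (envToLeft ε).toRingHom
  have : IsScalarTower (A ⊗[K] Aᵐᵒᵖ) A A := ⟨fun r a b => mul_assoc (envToLeft ε r) a b⟩
  have : IsScalarTower (A ⊗[K] Aᵐᵒᵖ) A K := ⟨fun r a c => by
    change ε (envToLeft ε r * a) * c = envAugmentation ε r * (ε a * c)
    rw [map_mul, augmentation_envToLeft, mul_assoc]⟩
  -- This bimodule is governed by right-`FP_n`, so left-`FP_n` is first converted by way of
  -- bi-`FP_n`.
  have htriv : ∀ n, LeftFP ε n → IsFP (A ⊗[K] Aᵐᵒᵖ) A n := fun n h =>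
    (G.isFP_trivialRight_iff_rightFP hG hε n).2
      ((G.biFP_iff_rightFP hG n).1 ((G.biFP_iff_leftFP hG n).2 h))
  constructor
  · intro h
    induction n with
    | zero =>
      have : Module.Finite (A ⊗[K] Aᵐᵒᵖ) K := IsFP.finite h
      exact isFP_zero_iff.2 (Module.Finite.of_restrictScalars_finite (A ⊗[K] Aᵐᵒᵖ) A K)
    -- Left-`FP_n` from the induction makes `A` of type `FP_n` over `Aᵉ`, just enough to descend
    -- `FP_{n+1}` of `K` to `A`.
    | succ n ih => exact IsFP.extendScalars (htriv n (ih (IsFP.mono n.le_succ h))) h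
  · exact fun h => IsFP.restrictScalars (htriv n h) h

end Enveloping

/-! ### Connected algebras and the conclusion -/

theorem IsConnected.proj_zero {K A : Type*} [Field K] [Ring A] [Algebra K A]
    {𝒜 : ℕ → Submodule K A} [GradedAlgebra 𝒜] (h : IsConnected 𝒜) (a : A) :
    (Grading.ofGradedAlgebra 𝒜).proj 0 a = algebraMap K A (h.augmentation a) := by
  induction a using (Grading.ofGradedAlgebra 𝒜).induction with
  | add x y hx hy => simp only [map_add, hx, hy]
  | mem i x hx =>
    rcases Nat.eq_zero_or_pos i with rfl | hi
    · rw [(Grading.ofGradedAlgebra 𝒜).proj_of_mem hx]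
      rw [h.zero_eq_span, Submodule.mem_span_singleton] at hx
      obtain ⟨c, rfl⟩ := hx
      rw [← Algebra.algebraMap_eq_smul_one, AlgHom.commutes]
      rfl
    · rw [(Grading.ofGradedAlgebra 𝒜).proj_of_mem_ne hx hi.ne', h.augmentation_apply_of_mem hi hx,
        map_zero]

/-- Serves all three structures on `K`: `rightModule ε` and `biModule ε` unfold to the structures
induced by `opAugmentation ε` and `envAugmentation ε`. -/
theorem isScalarTower_leftModule {K R : Type*} [Field K] [Ring R] [Algebra K R] (η : R →ₐ[K] K) :
    letI := leftModule η
    IsScalarTower K R K :=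
  isScalarTower_compHom (M := K) η

end HomFin

theorem theorem4 {K A : Type*} [Field K] [Ring A] [Algebra K A] (𝒜 : ℕ → Submodule K A)
    [GradedAlgebra 𝒜] (h𝒜 : HomFin.IsConnected 𝒜) (n : ℕ) :
    (HomFin.LeftFP h𝒜.augmentation n ∨ HomFin.RightFP h𝒜.augmentation n →
      HomFin.BiFP K A n) ∧
    [HomFin.LeftFP h𝒜.augmentation n,
      HomFin.RightFP h𝒜.augmentation n,
      HomFin.WeakBiFP h𝒜.augmentation n,
      HomFin.BiFP K A n,
      HomFin.GradedLeftFP 𝒜 h𝒜.augmentation n,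
      HomFin.GradedRightFP 𝒜 h𝒜.augmentation n,
      HomFin.GradedWeakBiFP 𝒜 h𝒜.augmentation n,
      HomFin.GradedBiFP 𝒜 n].TFAE := by
  let G := HomFin.Grading.ofGradedAlgebra 𝒜
  have hG := h𝒜.proj_zero
  have hε : ∀ i, 0 < i → ∀ a ∈ 𝒜 i, h𝒜.augmentation a = 0 :=
    fun i hi a ha => h𝒜.augmentation_apply_of_mem hi ha
  have hl := G.biFP_iff_leftFP hG n
  have hr := G.biFP_iff_rightFP hG n
  have hw := G.weakBiFP_iff_leftFP hG hε n
  have hgl : HomFin.LeftFP h𝒜.augmentation n ↔ HomFin.GradedLeftFP 𝒜 h𝒜.augmentation n := by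
    let := HomFin.leftModule h𝒜.augmentation
    have := HomFin.isScalarTower_leftModule h𝒜.augmentation
    exact ⟨HomFin.Grading.isGradedFP G (HomFin.groundGradingOf _ hε), HomFin.IsGradedFP.isFP⟩
  have hgr : HomFin.RightFP h𝒜.augmentation n ↔ HomFin.GradedRightFP 𝒜 h𝒜.augmentation n := by
    let := HomFin.rightModule h𝒜.augmentation
    have := HomFin.isScalarTower_leftModule (HomFin.opAugmentation h𝒜.augmentation)
    exact ⟨HomFin.Grading.isGradedFP G.op (HomFin.groundGradingOf _
      fun i hi a ha => hε i hi _ (HomFin.mem_opGrading.1 ha)), HomFin.IsGradedFP.isFP⟩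
  have hgw : HomFin.WeakBiFP h𝒜.augmentation n ↔
      HomFin.GradedWeakBiFP 𝒜 h𝒜.augmentation n := by
    let := HomFin.biModule h𝒜.augmentation
    have := HomFin.isScalarTower_leftModule (HomFin.envAugmentation h𝒜.augmentation)
    exact ⟨HomFin.Grading.isGradedFP G.env (HomFin.groundGradingOf _
      (HomFin.envAugmentation_eq_zero_of_mem hε)), HomFin.IsGradedFP.isFP⟩
  have hgb : HomFin.BiFP K A n ↔ HomFin.GradedBiFP 𝒜 n := by
    let := HomFin.selfBimodule K A
    have := HomFin.isScalarTower_selfBimodule K A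
    exact ⟨HomFin.Grading.isGradedFP G.env G.self, HomFin.IsGradedFP.isFP⟩
  refine ⟨fun h => h.elim hl.2 hr.2, ?_⟩
  tfae_have 4 ↔ 1 := hl
  tfae_have 4 ↔ 2 := hr
  tfae_have 3 ↔ 1 := hw
  tfae_have 1 ↔ 5 := hgl
  tfae_have 2 ↔ 6 := hgr
  tfae_have 3 ↔ 7 := hgw
  tfae_have 4 ↔ 8 := hgb
  tfae_finish
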